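/- Let $(W,S)$ be a Coxeter system (of arbitrary rank), with Bruhat order $\le$: $x\le w$ if some reduced expression for $x$ is a (not necessarily consecutive) subword of some reduced expression for $w$. Let $y<w$ in $W$, and fix a reduced expression $\mathsf w=\mathsf w_1\cdots\mathsf w_p$ for $w$. Masks. A mask on an expression $\mathsf v=\mathsf v_1\cdots\mathsf v_q$ is a vector $\sigma\in\{0,1\}^q$; it selects the subexpression consisting of the letters $\mathsf v_j$ with $\sigma_j=1$, whose product is denoted $\mathsf v^\sigma$. Write $\mathsf v^{\sigma[j]}$ for the product of the selected letters among the first $j$ positions. A position $j$ is a defect of $\sigma$ if $\mathsf v^{\sigma[j-1]}\mathsf v_j<\mathsf v^{\sigma[j-1]}$. The mask $\sigma$ is a constant mask on $\mathsf v$ for $x$ if it has no defects and $\mathsf v^\sigma=x$; if $\mathsf v$ is reduced, there is exactly one such mask for each $x\le \mathsf v_1\cdots \mathsf v_q$. Relative masks. For $x\in[y,w]$ let $\tau$ be the constant mask on $\mathsf w$ for $x$, and let $\nu$ be the constant mask for $y$ on the subexpression of $\mathsf w$ selected by $\tau$. The relative mask of $x$ is the vector $\sigma\in\{X,0,1\}^p$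 with $\sigma_j=X$ where $\tau_j=0$, and whose entries in the positions with $\tau_j=1$ are, in order, the entries of $\nu$. The mask $\tau$ is called the $X$-mask of $\sigma$. Let $\mathsf w^{\sigma[j]}$ be the product of the letters $\mathsf w_i$ with $i\le j$ and $\sigma_i=1$. A position $j$ is a defect of $\sigma$ if $\mathsf w^{\sigma[j-1]}\mathsf w_j<\mathsf w^{\sigma[j-1]}$, and a shifted descent of $\sigma$ if $\mathsf w^{\tau[j-1]}\ge\mathsf w^{\sigma[j]}$. The map $\varphi$. Given a relative mask $\sigma$ with $X$-mask $\tau$, find the rightmost position $j$ in which one of the following conditions holds, and apply the stated transformation to obtain $\varphi(\sigma)$: (1) if $\sigma_j=X$ and $j$ is not a defect, change $\sigma_j$ to $0$; (2) if $\sigma_j=0$, change $\sigma_j$ to $X$; (3) if $\sigma_j=X$ and $j$ is a defect, replace the entries of $\sigma$ in the positions $i<j$ with $\tau_i=1$ by the constant mask for $\mathsf w^{\sigma[j-1]}\mathsf w_j$ on the subexpression selected by $(\tau_1,\dots,\tau_{j-1})$, and set $\sigma_j$ to $1$; (4) if $\sigma_j=1$ and $j$ is a shifted descent, replace the entries of $\sigma$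 in the positions $i<j$ with $\tau_i=1$ by the constant mask for $\mathsf w^{\sigma[j]}$ on the subexpression selected by $(\tau_1,\dots,\tau_{j-1})$, and set $\sigma_j$ to $X$. Theorem. Each $x\in[y,w]$ has exactly one relative mask, and $\varphi$, regarded through this encoding as a map on $[y,w]$, is a complete acyclic matching of the Hasse diagram of Bruhat order on $[y,w]$. That is: $\varphi$ maps relative masks of elements of $[y,w]$ to relative masks of elements of $[y,w]$, and the pairs $\{u,v\}$ for which $\varphi$ sends the relative mask of $u$ to that of $v$ are edges of the Hasse diagram such that each element of $[y,w]$ lies in exactly one of them. Moreover, if the Hasse diagram is regarded as a directed graph with an edge $u\to v$ whenever $u$ covers $v$, and the direction of each matched edge is reversed, then the resulting directed graph has no directed cycles. -/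

import Mathlib

/-- The subexpression of the expression `ω` selected by the binary vector `σ`: the letters of `ω`
in the positions where `σ` has the value `1`. -/
def subexpression {B : Type*} : List B → List Bool → List B
  | i :: ω, true :: σ => i :: subexpression ω σ
  | _ :: ω, false :: σ => subexpression ω σ
  | _, _ => []

/-- The possible entries `X`, `0`, `1` of a relative mask. -/
inductive MaskEntry : Type
  | X : MaskEntry
  | zero : MaskEntry
  | one : MaskEntry

/-- The `X`-mask of a relative mask: `0` in the positions with entry `X`, and `1` elsewhere. -/
def xMask (σ : List MaskEntry) : List Bool :=
  σ.map fun e => match e with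
    | MaskEntry.X => false
    | MaskEntry.zero => true
    | MaskEntry.one => true

/-- The binary vector with value `1` in exactly the positions with entry `1`
(both `X` and `0` contribute the identity to the product encoded by a relative mask). -/
def oneMask (σ : List MaskEntry) : List Bool :=
  σ.map fun e => match e with
    | MaskEntry.X => false
    | MaskEntry.zero => false
    | MaskEntry.one => true

/-- Combine a mask `τ` with a mask `ν` on the subexpression selected by `τ`: write `X` where `τ`
is `0`, and distribute the entries of `ν`, in order, over the positions where `τ` is `1`. -/
def combineMasks : List Bool → List Bool → List MaskEntry
  | false :: τ, ν => MaskEntry.X :: combineMasks τ ν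
  | true :: τ, true :: ν => MaskEntry.one :: combineMasks τ ν
  | true :: τ, false :: ν => MaskEntry.zero :: combineMasks τ ν
  | _, _ => []

namespace CoxeterSystem

section

variable {B W : Type*} [Group W] {M : CoxeterMatrix B} (cs : CoxeterSystem M W)

/-- Bruhat order: some reduced expression for `x` is a (not necessarily consecutive) subword of
some reduced expression for `w`. -/
def BruhatLE (x w : W) : Prop :=
  ∃ η ω : List B, cs.IsReduced η ∧ cs.IsReduced ω ∧
    cs.wordProd η = x ∧ cs.wordProd ω = w ∧ η.Sublist ω

/-- Strict Bruhat order. -/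
def BruhatLT (x w : W) : Prop :=
  cs.BruhatLE x w ∧ x ≠ w

/-- The Bruhat interval `[y, w]`. -/
def bruhatInterval (y w : W) : Set W :=
  {x | cs.BruhatLE y x ∧ cs.BruhatLE x w}

/-- `u` covers `v` in Bruhat order. -/
def BruhatCovers (u v : W) : Prop :=
  cs.BruhatLT v u ∧ ∀ z, ¬ (cs.BruhatLT v z ∧ cs.BruhatLT z u)

/-- The Hasse diagram of `[y, w]` as a directed graph, with an edge `u → v` if `u` covers `v`. -/
def hasseEdge (y w : W) (u v : W) : Prop :=
  u ∈ cs.bruhatInterval y w ∧ v ∈ cs.bruhatInterval y w ∧ cs.BruhatCovers u v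

/-- The product of the initial subexpression consisting of the first `j` factors. -/
def initialProd (ω : List B) (σ : List Bool) (j : ℕ) : W :=
  cs.wordProd (subexpression (ω.take j) (σ.take j))

/-- The position of index `j` (counting from `0`) is a defect of the mask `σ` on `ω`:
multiplying the product of the earlier factors by the letter in this position goes down. The first
position is never a defect, because nothing lies below the identity. -/
def IsDefect (ω : List B) (σ : List Bool) (j : ℕ) : Prop :=
  ∃ i, ω[j]? = some i ∧
    cs.BruhatLT (cs.initialProd ω σ j * cs.simple i) (cs.initialProd ω σ j)

/-- `σ` is a constant mask on the expression `ω` for the element `x`: a binary vector of the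
length of `ω` without defects, whose subexpression has product `x`. -/
def IsConstantMask (ω : List B) (x : W) (σ : List Bool) : Prop :=
  σ.length = ω.length ∧ cs.wordProd (subexpression ω σ) = x ∧ ∀ j, ¬ cs.IsDefect ω σ j

/-- The (unique) constant mask on the reduced expression `ω` for an element `x` below the product
of `ω`. -/
noncomputable def constantMask (ω : List B) (x : W) : List Bool :=
  Classical.epsilon (cs.IsConstantMask ω x)

/-- `σ` is the relative mask on `ω` that encodes the pair `y ≤ x`: it combines the constant mask
`τ` on `ω` for `x` with the constant mask on the subexpression selected by `τ` for `y`. -/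
def IsRelativeMask (ω : List B) (y x : W) (σ : List MaskEntry) : Prop :=
  ∃ τ ν : List Bool, cs.IsConstantMask ω x τ ∧
    cs.IsConstantMask (subexpression ω τ) y ν ∧ σ = combineMasks τ ν

/-- The position of index `j` (counting from `0`) is a shifted descent of the relative mask `σ`
with `X`-mask `τ`: the product of the first `j` factors given by `τ` lies above the product of the
first `j + 1` factors given by `σ`. -/
def IsShiftedDescent (ω : List B) (σ : List MaskEntry) (j : ℕ) : Prop :=
  cs.BruhatLE (cs.initialProd ω (oneMask σ) (j + 1)) (cs.initialProd ω (xMask σ) j)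

/-- Replace the non-`X` entries of `σ` left of the position `j` by the constant mask for `x` on
the subexpression which the `X`-mask of `σ` selects there, and set the entry in position `j`
to `e`. -/
noncomputable def rewriteAt (ω : List B) (σ : List MaskEntry) (j : ℕ) (x : W) (e : MaskEntry) :
    List MaskEntry :=
  combineMasks ((xMask σ).take j)
      (cs.constantMask (subexpression (ω.take j) ((xMask σ).take j)) x) ++
    e :: σ.drop (j + 1)

/-- First condition: an entry `X` that is not a defect. -/
def Move₁ (ω : List B) (σ : List MaskEntry) (j : ℕ) : Prop :=
  σ[j]? = some MaskEntry.X ∧ ¬ cs.IsDefect ω (oneMask σ) j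

/-- Second condition: an entry `0`. -/
def Move₂ (σ : List MaskEntry) (j : ℕ) : Prop :=
  σ[j]? = some MaskEntry.zero

/-- Third condition: an entry `X` that is a defect. -/
def Move₃ (ω : List B) (σ : List MaskEntry) (j : ℕ) : Prop :=
  σ[j]? = some MaskEntry.X ∧ cs.IsDefect ω (oneMask σ) j

/-- Fourth condition: an entry `1` that is a shifted descent. -/
def Move₄ (ω : List B) (σ : List MaskEntry) (j : ℕ) : Prop :=
  σ[j]? = some MaskEntry.one ∧ cs.IsShiftedDescent ω σ j

/-- One of the four conditions holds in position `j`. -/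
def IsMove (ω : List B) (σ : List MaskEntry) (j : ℕ) : Prop :=
  cs.Move₁ ω σ j ∨ Move₂ σ j ∨ cs.Move₃ ω σ j ∨ cs.Move₄ ω σ j

open Classical in
/-- The transformation belonging to the condition that holds in position `j`. In the third case,
the product of the first `j` factors times the letter in position `j` is the product of the first
`j` factors followed by that letter. -/
noncomputable def applyMove (ω : List B) (σ : List MaskEntry) (j : ℕ) : List MaskEntry :=
  if cs.Move₁ ω σ j then σ.set j MaskEntry.zero
  else if Move₂ σ j then σ.set j MaskEntry.X
  else if cs.Move₃ ω σ j then
    cs.rewriteAt ω σ j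
      (cs.initialProd ω (oneMask σ) j * cs.wordProd ω[j]?.toList) MaskEntry.one
  else if cs.Move₄ ω σ j then
    cs.rewriteAt ω σ j (cs.initialProd ω (oneMask σ) (j + 1)) MaskEntry.X
  else σ

open Classical in
/-- The map `φ`: apply the transformation in the rightmost position where one of the four
conditions holds (and change nothing if there is no such position). -/
noncomputable def maskMatching (ω : List B) (σ : List MaskEntry) : List MaskEntry :=
  if ∃ j, cs.IsMove ω σ j then
    cs.applyMove ω σ (Nat.findGreatest (cs.IsMove ω σ) ω.length)
  else σ

/-- `u` and `v` in `[y, w]`, where `ω` is a reduced expression for `w`, are matched by `φ`: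
it sends the relative mask encoding `u` to the relative mask encoding `v`. -/
def Matched (ω : List B) (y : W) (u v : W) : Prop :=
  u ∈ cs.bruhatInterval y (cs.wordProd ω) ∧ v ∈ cs.bruhatInterval y (cs.wordProd ω) ∧
    ∃ σ, cs.IsRelativeMask ω y u σ ∧ cs.IsRelativeMask ω y v (cs.maskMatching ω σ)

end

end CoxeterSystem

/-- `m` is (the adjacency relation of) a matching of the directed graph with edge relation `E`:
a set of edges, taken without their direction, no two of which share a vertex. -/
def IsMatchingOf {V : Type*} (E m : V → V → Prop) : Prop :=
  (∀ u v, m u v → m v u) ∧ (∀ u v, m u v → E u v ∨ E v u) ∧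
    ∀ u v v', m u v → m u v' → v = v'

/-- The directed graph `E` with the direction of the edges in `m` reversed. -/
def reverseMatched {V : Type*} (E m : V → V → Prop) (u v : V) : Prop :=
  (E u v ∧ ¬ m u v) ∨ (E v u ∧ m v u)

/-- There is no directed cycle, that is, no closed directed walk of positive length, after the
direction of the edges in `m` has been reversed. -/
def IsAcyclicMatching {V : Type*} (E m : V → V → Prop) : Prop :=
  ∀ u, ¬ Relation.TransGen (reverseMatched E m) u u

/-! Everything is decided from the right end of the expression. For an expression `ω ++ [s]`, the
last entry of the relative mask of `x` is `X` if `s` is not a right descent of `x`, `0` if it is one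
of `x` only, and `1` if it is one of `x` and of `y` (`isRelativeMask_concat`). A move is possible
there exactly when `y ≤ xs`: for `X` and `0` this inequality is automatic by lifting, and for `1` it
is the definition of a shifted descent. Whichever move it is, it replaces `x` by `xs`. If there is
none, `s` is a right descent of `x` and of `y`, and the same question arises for `ω`, `ys` and `xs`.
Unwinding this, the rightmost move at a letter `t` followed by `c` means `x = zc`, `y = vc`, with
only entries `1` and no shifted descents along `c`, and `φ` sends `zc` to `ztc`. This is
`MatchingStep`.

The crux is that `φ` is an involution: passing from `z` to `zt` must not create a shifted descent
along `c`. This is `noShiftedDescent_mul_simple_iff`, which rests on `le_of_noShiftedDescent`. The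
absence of shifted descents also makes lengths add along `c`, so that `zc` and `ztc` differ in
length by one and form a cover.

For acyclicity, the truth of `y ≤ xs` is constant along a directed cycle. Where it is false, right
multiplication by `s` carries the cycle to the interval for `ω` and `ys`. Where it is true, the
minimal length in the coset `{x, xs}` is constant too, which leaves only reversed edges, and these
increase length.

The Bruhat order facts (subword property, lifting) come from the strong exchange property, which is
derived from an action of `W` on `W × ZMod 2`. -/

namespace CoxeterSystem

/-! ### Strong exchange through the action on `W × ZMod 2`. -/

section StrongExchange

variable {B W : Type*} [Group W] {M : CoxeterMatrix B} (cs : CoxeterSystem M W)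

open Classical in
/-- The permutation of `W × ZMod 2` which conjugates the first component by a simple reflection
and changes the second component if the first one is that simple reflection. -/
noncomputable def signedConj (i : B) : Function.End (W × ZMod 2) := fun p =>
  (cs.simple i * p.1 * cs.simple i, p.2 + if p.1 = cs.simple i then 1 else 0)

-- Each letter changes the sign precisely when the conjugate reached so far is that letter, that is,
-- when `t` is the corresponding right inversion; the signs therefore count occurrences of `t`.
open Classical in
theorem prod_map_signedConj (ω : List B) (t : W) (e : ZMod 2) :
    ((ω.map cs.signedConj).prod : Function.End (W × ZMod 2)) (t, e) =
      (cs.wordProd ω * t * (cs.wordProd ω)⁻¹, e + ((cs.rightInvSeq ω).count t : ZMod 2)) := by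
  induction ω with
  | nil => simp; rfl
  | cons i ω ih =>
    rw [List.map_cons, List.prod_cons]
    change cs.signedConj i (((ω.map cs.signedConj).prod : Function.End (W × ZMod 2)) (t, e)) = _
    rw [ih, rightInvSeq, List.count_cons, wordProd_cons, signedConj]
    have h : cs.wordProd ω * t * (cs.wordProd ω)⁻¹ = cs.simple i ↔
        (cs.wordProd ω)⁻¹ * cs.simple i * cs.wordProd ω = t := by
      constructor
      · rintro h; rw [← h]; group
      · rintro rfl; group
    simp only [h, beq_iff_eq, mul_inv_rev, inv_simple, Nat.cast_add, Nat.cast_ite, Nat.cast_one,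
      Nat.cast_zero]
    refine Prod.ext ?_ ?_
    · simp [mul_assoc]
    · simp [add_assoc]

-- The inversions of the relator `(ij)^m` repeat with period `m`, so the second half of the sequence
-- is a copy of the first. This is what makes the sign respect the braid relations.
open Classical in
theorem even_count_leftInvSeq_alternatingWord (i j : B) (t : W) :
    Even ((cs.leftInvSeq (alternatingWord i j (2 * M i j))).count t) := by
  set l := cs.leftInvSeq (alternatingWord i j (2 * M i j)) with hl
  have hlen : l.length = 2 * M i j := by simp [hl]
  have key : l.drop (M i j) = l.take (M i j) := by
    apply List.ext_getElem
    · simp [hlen]; omega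
    · intro k h1 h2
      have hk : k < M i j := by simp [hlen] at h2; omega
      rw [List.getElem_drop, List.getElem_take]
      simp only [hl]
      rw [getElem_leftInvSeq_alternatingWord _ _ _ _ _ (by omega),
        getElem_leftInvSeq_alternatingWord _ _ _ _ _ (by omega),
        prod_alternatingWord_eq_mul_pow, prod_alternatingWord_eq_mul_pow]
      have e1 : (2 * (M i j + k) + 1) / 2 = M i j + k := by omega
      have e2 : (2 * k + 1) / 2 = k := by omega
      rw [e1, e2, pow_add, simple_mul_simple_pow']
      simp
  rw [← List.take_append_drop (M i j) l, key, List.count_append]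
  exact ⟨_, rfl⟩

theorem map_alternatingWord_prod {G : Type*} [Monoid G] (f : B → G) (i j : B) (m : ℕ) :
    ((alternatingWord i j (2 * m)).map f).prod = (f i * f j) ^ m := by
  induction m with
  | zero => simp [alternatingWord]
  | succ m ih =>
    rw [show 2 * (m + 1) = 2 * m + 1 + 1 by ring, alternatingWord_succ, alternatingWord_succ,
      pow_succ, ← ih]
    simp

theorem isLiftable_signedConj : M.IsLiftable cs.signedConj := by
  classical
  intro i j
  rw [← map_alternatingWord_prod]
  funext ⟨t, e⟩
  rw [prod_map_signedConj]
  have h1 : cs.wordProd (alternatingWord i j (2 * M i j)) = 1 := by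
    rw [wordProd, map_alternatingWord_prod, simple_mul_simple_pow]
  have h2 : ((cs.rightInvSeq (alternatingWord i j (2 * M i j))).count t : ZMod 2) = 0 := by
    have := cs.even_count_leftInvSeq_alternatingWord j i t
    rw [ZMod.natCast_eq_zero_iff_even]
    have hr : (alternatingWord i j (2 * M i j)) = (alternatingWord j i (2 * M i j)).reverse := by
      apply List.ext_getElem
      · simp
      · intro k h1 h2
        simp at h1 h2
        rw [List.getElem_reverse, getElem_alternatingWord _ _ _ _ h1,
          getElem_alternatingWord _ _ _ _ (by simp; omega)]
        simp only [length_alternatingWord, Nat.even_iff]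
        split_ifs <;> first | rfl | omega
    rw [hr, rightInvSeq_reverse, List.count_reverse, M.symmetric i j]
    exact this
  rw [h1, h2]
  simp
  rfl

/-- The action of `W` on `W × ZMod 2` by conjugation of the first component which records the
inversions in the second component. -/
noncomputable def signedConjHom : W →* Function.End (W × ZMod 2) :=
  cs.lift ⟨cs.signedConj, cs.isLiftable_signedConj⟩

open Classical in
theorem signedConjHom_wordProd (ω : List B) (t : W) (e : ZMod 2) :
    cs.signedConjHom (cs.wordProd ω) (t, e) =
      (cs.wordProd ω * t * (cs.wordProd ω)⁻¹, e + ((cs.rightInvSeq ω).count t : ZMod 2)) := by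
  have h : cs.signedConjHom ∘ cs.simple = cs.signedConj :=
    funext fun i => cs.lift_apply_simple cs.isLiftable_signedConj i
  rw [← prod_map_signedConj, wordProd, map_list_prod, List.map_map, h]

/-- The parity of the number of occurrences of `t` among the right inversions of any expression
for `w`. -/
noncomputable def inversionParity (w t : W) : ZMod 2 := (cs.signedConjHom w (t, 0)).2

theorem signedConjHom_apply (w t : W) (e : ZMod 2) :
    cs.signedConjHom w (t, e) = (w * t * w⁻¹, e + cs.inversionParity w t) := by
  obtain ⟨ω, rfl⟩ := cs.wordProd_surjective w
  simp only [inversionParity, signedConjHom_wordProd, zero_add]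

theorem inversionParity_mul (w w' t : W) :
    cs.inversionParity (w * w') t =
      cs.inversionParity w' t + cs.inversionParity w (w' * t * w'⁻¹) := by
  have h : cs.signedConjHom (w * w') (t, 0) = cs.signedConjHom w (cs.signedConjHom w' (t, 0)) := by
    rw [map_mul]; rfl
  rw [signedConjHom_apply, signedConjHom_apply, signedConjHom_apply] at h
  simpa using congrArg Prod.snd h

theorem inversionParity_one (t : W) : cs.inversionParity 1 t = 0 := by
  rw [inversionParity, map_one]; rfl

theorem inversionParity_self {t : W} (ht : cs.IsReflection t) : cs.inversionParity t t = 1 := by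
  classical
  obtain ⟨u, i, rfl⟩ := ht
  have h1 := cs.inversionParity_mul u⁻¹ u (cs.simple i)
  have h2 : cs.inversionParity (cs.simple i) (cs.simple i) = 1 := by
    have := cs.signedConjHom_wordProd [i] (cs.simple i) 0
    rw [wordProd_singleton] at this
    rw [inversionParity, this]
    simp
  rw [inv_mul_cancel, inversionParity_one] at h1
  rw [inversionParity_mul, inversionParity_mul]
  have e1 : u⁻¹ * (u * cs.simple i * u⁻¹) * u⁻¹⁻¹ = cs.simple i := by group
  have e2 : cs.simple i * cs.simple i * (cs.simple i)⁻¹ = cs.simple i := by simp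
  rw [e1, e2, h2]
  linear_combination -h1

theorem mem_rightInvSeq_of_inversionParity_ne {ω : List B} {t : W}
    (h : cs.inversionParity (cs.wordProd ω) t ≠ 0) : t ∈ cs.rightInvSeq ω := by
  classical
  rw [inversionParity, signedConjHom_wordProd] at h
  by_contra hn
  rw [List.count_eq_zero_of_not_mem hn] at h
  simp at h

theorem length_mul_lt_of_inversionParity_ne {w t : W} (h : cs.inversionParity w t ≠ 0) :
    cs.length (w * t) < cs.length w := by
  obtain ⟨ω, hω, rfl⟩ := cs.exists_isReduced w
  exact (cs.isRightInversion_of_mem_rightInvSeq hω (cs.mem_rightInvSeq_of_inversionParity_ne h)).2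

/-- By the cocycle rule and `inversionParity_self`, the parities of `w` and `w * t` at `t` differ by
one. If that of `w` vanished, `t` would be an inversion of `w * t`, and `w` would be the shorter
element. -/
theorem inversionParity_ne_of_length_mul_lt {w t : W} (ht : cs.IsReflection t)
    (h : cs.length (w * t) < cs.length w) : cs.inversionParity w t ≠ 0 := by
  intro h0
  have h1 : cs.inversionParity (w * t) t ≠ 0 := by
    rw [inversionParity_mul, cs.inversionParity_self ht, ht.mul_self, one_mul, ht.inv, h0]
    decide
  have := cs.length_mul_lt_of_inversionParity_ne h1
  rw [mul_assoc, ht.mul_self, mul_one] at this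
  omega

/-- The strong exchange property. -/
theorem strong_exchange {ω : List B} {t : W} (ht : cs.IsReflection t)
    (h : cs.length (cs.wordProd ω * t) < cs.length (cs.wordProd ω)) :
    ∃ j < ω.length, cs.wordProd ω * t = cs.wordProd (ω.eraseIdx j) := by
  have hm := cs.mem_rightInvSeq_of_inversionParity_ne (cs.inversionParity_ne_of_length_mul_lt ht h)
  obtain ⟨j, hj, rfl⟩ := List.mem_iff_getElem.mp hm
  refine ⟨j, by simpa using hj, ?_⟩
  rw [← wordProd_mul_getD_rightInvSeq, List.getD_eq_getElem _ _ hj]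

end StrongExchange

end CoxeterSystem

namespace CoxeterSystem

/-! ### Bruhat order: subword property and lifting. -/

section BruhatOrder

variable {B W : Type*} [Group W] {M : CoxeterMatrix B} (cs : CoxeterSystem M W)

/-- When a new letter lowers the length, strong exchange cancels it against an earlier letter, and
both are dropped. -/
theorem exists_reduced_sublist (ω : List B) :
    ∃ η, η.Sublist ω ∧ cs.IsReduced η ∧ cs.wordProd η = cs.wordProd ω := by
  induction ω using List.reverseRecOn with
  | nil => exact ⟨[], List.Sublist.refl _, by simp [IsReduced], rfl⟩
  | append_singleton ω s ih =>
    obtain ⟨η, h1, h2, h3⟩ := ih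
    rcases cs.length_mul_simple (cs.wordProd η) s with h | h
    · refine ⟨η ++ [s], h1.append (List.Sublist.refl _), ?_, ?_⟩
      · rw [IsReduced, wordProd_append, wordProd_singleton, h, h2.eq]; simp
      · simp [wordProd_append, h3]
    · obtain ⟨j, hj, e⟩ := cs.strong_exchange (ω := η) (cs.isReflection_simple s) (by omega)
      refine ⟨η.eraseIdx j, ((List.eraseIdx_sublist _ _).trans h1).trans
        (List.sublist_append_left _ _), ?_, ?_⟩
      · rw [IsReduced, ← e, List.length_eraseIdx_of_lt hj, ← h2.eq]; omega
      · rw [← e, h3]; simp [wordProd_append]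

/-- The relation `u → u t` for a reflection `t` which increases the length. -/
def BruhatStep (u v : W) : Prop :=
  ∃ t, cs.IsReflection t ∧ v = u * t ∧ cs.length u < cs.length v

theorem exists_sublist_of_bruhatStep {x w : W} (h : Relation.ReflTransGen cs.BruhatStep x w)
    (ω : List B) (hω : cs.wordProd ω = w) : ∃ η, η.Sublist ω ∧ cs.wordProd η = x := by
  induction h using Relation.ReflTransGen.head_induction_on with
  | refl => exact ⟨ω, List.Sublist.refl _, hω⟩
  | head h _ ih =>
    obtain ⟨η, h1, h2⟩ := ih
    obtain ⟨t, ht, rfl, hl⟩ := h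
    obtain ⟨j, -, e⟩ := cs.strong_exchange (ω := η) ht (by
      rw [h2, mul_assoc, ht.mul_self, mul_one]; exact hl)
    refine ⟨_, (List.eraseIdx_sublist η j).trans h1, ?_⟩
    rw [← e, h2, mul_assoc, ht.mul_self, mul_one]

theorem bruhatStep_mul_simple {w : W} {s : B} (h : ¬ cs.IsRightDescent w s) :
    cs.BruhatStep w (w * cs.simple s) :=
  ⟨_, cs.isReflection_simple s, rfl, by rw [cs.not_isRightDescent_iff.mp h]; omega⟩

/-- If the step is not preserved, strong exchange deletes a letter from a word `ω ++ [s]` for `u *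
s`. Deleting inside `ω` would make `v` shorter than `u`, so the deleted letter is the final `s`, and
`u = v * s`. -/
theorem BruhatStep.mul_simple {u v : W} (h : cs.BruhatStep u v) (s : B) :
    u * cs.simple s = v ∨ cs.BruhatStep (u * cs.simple s) (v * cs.simple s) := by
  obtain ⟨t, ht, rfl, hl⟩ := h
  have hr : cs.IsReflection (cs.simple s * t * cs.simple s) := by
    simpa using ht.conj (cs.simple s)
  have he : u * t * cs.simple s = u * cs.simple s * (cs.simple s * t * cs.simple s) := by
    simp [mul_assoc]
  by_cases hlt : cs.length (u * cs.simple s) < cs.length (u * t * cs.simple s)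
  · exact Or.inr ⟨_, hr, he, hlt⟩
  · left
    have hne := hr.length_mul_left_ne (u * cs.simple s)
    rw [← he] at hne
    obtain ⟨ω, hω, rfl⟩ := cs.exists_isReduced u
    have h1 := cs.length_mul_simple (cs.wordProd ω) s
    have h2 := cs.length_mul_simple (cs.wordProd ω * t) s
    have hp : cs.wordProd (ω ++ [s]) = cs.wordProd ω * cs.simple s := by simp [wordProd_append]
    obtain ⟨j, hj, e⟩ := cs.strong_exchange (ω := ω ++ [s]) hr (by rw [hp, ← he]; omega)
    rw [hp, ← he] at e
    by_cases hjl : j < ω.length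
    · rw [List.eraseIdx_append_of_lt_length hjl, wordProd_append, wordProd_singleton,
        mul_left_inj] at e
      have := cs.length_wordProd_le (ω.eraseIdx j)
      rw [← e, List.length_eraseIdx_of_lt hjl] at this
      have := hω.eq
      omega
    · have : j = ω.length := by simp at hj; omega
      subst this
      rw [List.eraseIdx_append_of_length_le le_rfl] at e
      simp only [Nat.sub_self, List.eraseIdx_cons_zero, List.append_nil] at e
      simpa using (congrArg (· * cs.simple s) e).symm

theorem reflTransGen_bruhatStep_mul_simple {x w : W}
    (h : Relation.ReflTransGen cs.BruhatStep x w) {s : B} (hs : ¬ cs.IsRightDescent w s) :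
    Relation.ReflTransGen cs.BruhatStep (x * cs.simple s) (w * cs.simple s) := by
  induction h using Relation.ReflTransGen.head_induction_on with
  | refl => exact Relation.ReflTransGen.refl
  | head h h' ih =>
    rcases BruhatStep.mul_simple cs h s with e | e
    · rw [e]
      exact h'.tail (cs.bruhatStep_mul_simple hs)
    · exact ih.head e

theorem isReduced_append_singleton {ω : List B} {s : B} (h : cs.IsReduced (ω ++ [s])) :
    cs.IsReduced ω ∧ ¬ cs.IsRightDescent (cs.wordProd ω) s := by
  have h1 : cs.IsReduced ω := by simpa using h.take ω.length
  refine ⟨h1, ?_⟩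
  have := h.eq
  rw [wordProd_append, wordProd_singleton, List.length_append] at this
  rw [cs.not_isRightDescent_iff, this, h1.eq]; rfl

theorem reflTransGen_bruhatStep_of_sublist {ω η : List B} (hω : cs.IsReduced ω)
    (h : η.Sublist ω) :
    Relation.ReflTransGen cs.BruhatStep (cs.wordProd η) (cs.wordProd ω) := by
  induction ω using List.reverseRecOn generalizing η with
  | nil => rw [List.sublist_nil.mp h]
  | append_singleton ω s ih =>
    obtain ⟨h1, h2⟩ := cs.isReduced_append_singleton hω
    obtain ⟨η₁, η₂, rfl, h3, h4⟩ := List.sublist_append_iff.mp h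
    rw [wordProd_append, wordProd_append]
    rcases List.sublist_cons_iff.mp h4 with h5 | ⟨r, rfl, h5⟩
    · rw [List.sublist_nil.mp h5]
      simpa using (ih h1 h3).tail (cs.bruhatStep_mul_simple h2)
    · rw [List.sublist_nil.mp h5]
      simpa using cs.reflTransGen_bruhatStep_mul_simple (ih h1 h3) h2

/-- The description by reflections makes transitivity evident and shows that any expression of the
larger element may be used to find the smaller one. -/
theorem bruhatLE_iff_reflTransGen {x w : W} :
    cs.BruhatLE x w ↔ Relation.ReflTransGen cs.BruhatStep x w := by
  constructor
  · rintro ⟨η, ω, -, h, rfl, rfl, hs⟩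
    exact cs.reflTransGen_bruhatStep_of_sublist h hs
  · intro h
    obtain ⟨ω, h1, rfl⟩ := cs.exists_isReduced w
    obtain ⟨η, h2, h3⟩ := cs.exists_sublist_of_bruhatStep h ω rfl
    obtain ⟨η', h4, h5, h6⟩ := cs.exists_reduced_sublist η
    exact ⟨η', ω, h5, h1, h6.trans h3, rfl, h4.trans h2⟩

/-- The subword property. -/
theorem exists_reduced_sublist_of_bruhatLE {x : W} {ω : List B}
    (h : cs.BruhatLE x (cs.wordProd ω)) :
    ∃ η, η.Sublist ω ∧ cs.IsReduced η ∧ cs.wordProd η = x := by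
  obtain ⟨η, h2, h3⟩ :=
    cs.exists_sublist_of_bruhatStep (cs.bruhatLE_iff_reflTransGen.mp h) ω rfl
  obtain ⟨η', h4, h5, h6⟩ := cs.exists_reduced_sublist η
  exact ⟨η', h4.trans h2, h5, h6.trans h3⟩

theorem bruhatLE_of_sublist {ω η : List B} (hω : cs.IsReduced ω) (h : η.Sublist ω) :
    cs.BruhatLE (cs.wordProd η) (cs.wordProd ω) :=
  cs.bruhatLE_iff_reflTransGen.mpr (cs.reflTransGen_bruhatStep_of_sublist hω h)

variable {cs}

theorem BruhatLE.trans {x y z : W} (h : cs.BruhatLE x y) (h' : cs.BruhatLE y z) :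
    cs.BruhatLE x z :=
  cs.bruhatLE_iff_reflTransGen.mpr
    ((cs.bruhatLE_iff_reflTransGen.mp h).trans (cs.bruhatLE_iff_reflTransGen.mp h'))

theorem BruhatLE.length_le {x y : W} (h : cs.BruhatLE x y) : cs.length x ≤ cs.length y := by
  obtain ⟨η, ω, h1, h2, rfl, rfl, h3⟩ := h
  rw [h1.eq, h2.eq]
  exact h3.length_le

theorem BruhatLE.eq_of_length_le {x y : W} (h : cs.BruhatLE x y)
    (hl : cs.length y ≤ cs.length x) : x = y := by
  obtain ⟨η, ω, h1, h2, rfl, rfl, h3⟩ := h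
  rw [h1.eq, h2.eq] at hl
  rw [h3.eq_of_length_le hl]

theorem BruhatLE.inv {x y : W} (h : cs.BruhatLE x y) : cs.BruhatLE x⁻¹ y⁻¹ := by
  obtain ⟨η, ω, h1, h2, rfl, rfl, h3⟩ := h
  exact ⟨η.reverse, ω.reverse, h1.reverse, h2.reverse, by simp, by simp, h3.reverse⟩

theorem BruhatLT.length_lt {x y : W} (h : cs.BruhatLT x y) : cs.length x < cs.length y := by
  by_contra hn
  exact h.2 (h.1.eq_of_length_le (by omega))

theorem BruhatLE.bruhatLT {x y : W} (h : cs.BruhatLE x y) (hl : cs.length x < cs.length y) :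
    cs.BruhatLT x y :=
  ⟨h, by rintro rfl; omega⟩

theorem BruhatLE.bruhatCovers {x y : W} (h : cs.BruhatLE x y)
    (hl : cs.length y = cs.length x + 1) : cs.BruhatCovers y x := by
  refine ⟨h.bruhatLT (by omega), fun z hz => ?_⟩
  have := hz.1.length_lt
  have := hz.2.length_lt
  omega

theorem bruhatLE_mul_simple {w : W} {s : B} (h : ¬ cs.IsRightDescent w s) :
    cs.BruhatLE w (w * cs.simple s) :=
  cs.bruhatLE_iff_reflTransGen.mpr (.single (cs.bruhatStep_mul_simple h))

theorem mul_simple_bruhatLE {w : W} {s : B} (h : cs.IsRightDescent w s) :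
    cs.BruhatLE (w * cs.simple s) w := by
  simpa using bruhatLE_mul_simple (cs.isRightDescent_iff_not_isRightDescent_mul.mp h)

theorem bruhatLT_mul_simple_iff {w : W} {s : B} :
    cs.BruhatLT (w * cs.simple s) w ↔ cs.IsRightDescent w s :=
  ⟨fun h => h.length_lt, fun h => (mul_simple_bruhatLE h).bruhatLT h⟩

/-- Lifting, where `s` is not a descent of the larger element. -/
theorem BruhatLE.mul_simple_mul_simple {x w : W} (h : cs.BruhatLE x w) {s : B}
    (hs : ¬ cs.IsRightDescent w s) : cs.BruhatLE (x * cs.simple s) (w * cs.simple s) :=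
  cs.bruhatLE_iff_reflTransGen.mpr
    (cs.reflTransGen_bruhatStep_mul_simple (cs.bruhatLE_iff_reflTransGen.mp h) hs)

theorem BruhatLE.mul_simple_of_not_isRightDescent {x w : W} (h : cs.BruhatLE x w) {s : B}
    (hs : ¬ cs.IsRightDescent w s) : cs.BruhatLE x (w * cs.simple s) :=
  h.trans (bruhatLE_mul_simple hs)

theorem BruhatLE.le_mul_simple_or {x w : W} (h : cs.BruhatLE x w) (s : B) :
    (cs.BruhatLE x (w * cs.simple s)) ∨
      (cs.IsRightDescent x s ∧ cs.BruhatLE (x * cs.simple s) (w * cs.simple s)) := by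
  obtain ⟨ω, h1, h2⟩ := cs.exists_isReduced (w * cs.simple s)
  -- This word need not be reduced; the subword property holds for it all the same. The two
  -- alternatives are whether a subword for `x` avoids or uses the final `s`.
  have h2' : w = cs.wordProd (ω ++ [s]) := by simp [wordProd_append, ← h2]
  have h : cs.BruhatLE x (cs.wordProd (ω ++ [s])) := h2' ▸ h
  obtain ⟨η, h3, h4, rfl⟩ := cs.exists_reduced_sublist_of_bruhatLE h
  obtain ⟨η₁, η₂, rfl, h5, h6⟩ := List.sublist_append_iff.mp h3
  rcases List.sublist_cons_iff.mp h6 with h7 | ⟨r, rfl, h7⟩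
  · left
    rw [List.sublist_nil.mp h7, h2, List.append_nil]
    exact cs.bruhatLE_of_sublist h1 h5
  · right
    rw [List.sublist_nil.mp h7] at h4 ⊢
    rw [h2]
    have := (cs.isReduced_append_singleton h4).2
    rw [wordProd_append, wordProd_singleton, simple_mul_simple_cancel_right]
    refine ⟨?_, cs.bruhatLE_of_sublist h1 h5⟩
    rw [isRightDescent_iff_not_isRightDescent_mul, simple_mul_simple_cancel_right]
    exact this

/-- Lifting, where `s` is not a descent of the smaller element. -/
theorem BruhatLE.le_mul_simple {x w : W} (h : cs.BruhatLE x w) {s : B}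
    (hx : ¬ cs.IsRightDescent x s) :
    cs.BruhatLE x (w * cs.simple s) :=
  (h.le_mul_simple_or s).resolve_right fun h => hx h.1

theorem BruhatLE.mul_simple_le {x w : W} (h : cs.BruhatLE x w) {s : B}
    (hw : cs.IsRightDescent w s) : cs.BruhatLE (x * cs.simple s) w := by
  have hw' := cs.isRightDescent_iff_not_isRightDescent_mul.mp hw
  by_cases hx : cs.IsRightDescent x s
  · exact (mul_simple_bruhatLE hx).trans h
  · simpa using (h.le_mul_simple hx).mul_simple_mul_simple hw'

/-- Lifting, where `s` is a descent of the smaller element. -/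
theorem BruhatLE.mul_simple_mul_simple_of_isRightDescent {x w : W} (h : cs.BruhatLE x w) {s : B}
    (hx : cs.IsRightDescent x s) :
    cs.BruhatLE (x * cs.simple s) (w * cs.simple s) := by
  rcases h.le_mul_simple_or s with h | h
  · exact (mul_simple_bruhatLE hx).trans h
  · exact h.2

theorem BruhatLE.simple_mul_simple_mul {x w : W} (h : cs.BruhatLE x w) {s : B}
    (hs : ¬ cs.IsLeftDescent w s) : cs.BruhatLE (cs.simple s * x) (cs.simple s * w) := by
  rw [← cs.isRightDescent_inv_iff] at hs
  simpa using (h.inv.mul_simple_mul_simple hs).inv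

theorem bruhatLE_simple_mul {w : W} {s : B} (h : ¬ cs.IsLeftDescent w s) :
    cs.BruhatLE w (cs.simple s * w) := by
  rw [← cs.isRightDescent_inv_iff] at h
  simpa using (bruhatLE_mul_simple h).inv

theorem simple_mul_bruhatLE {w : W} {s : B} (h : cs.IsLeftDescent w s) :
    cs.BruhatLE (cs.simple s * w) w := by
  simpa using bruhatLE_simple_mul (cs.isLeftDescent_iff_not_isLeftDescent_mul.mp h)

theorem BruhatLE.le_simple_mul {x w : W} (h : cs.BruhatLE x w) {s : B}
    (hx : ¬ cs.IsLeftDescent x s) :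
    cs.BruhatLE x (cs.simple s * w) := by
  rw [← cs.isRightDescent_inv_iff] at hx
  simpa using (h.inv.le_mul_simple hx).inv

theorem BruhatLE.simple_mul_le {x w : W} (h : cs.BruhatLE x w) {s : B}
    (hw : cs.IsLeftDescent w s) : cs.BruhatLE (cs.simple s * x) w := by
  rw [← cs.isRightDescent_inv_iff] at hw
  simpa using (h.inv.mul_simple_le hw).inv

theorem BruhatLE.simple_mul_simple_mul_of_isLeftDescent {x w : W} (h : cs.BruhatLE x w) {s : B}
    (hx : cs.IsLeftDescent x s) :
    cs.BruhatLE (cs.simple s * x) (cs.simple s * w) := by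
  rw [← cs.isRightDescent_inv_iff] at hx
  simpa using (h.inv.mul_simple_mul_simple_of_isRightDescent hx).inv

end BruhatOrder

end CoxeterSystem

namespace CoxeterSystem

/-! ### Shifted descents, and their invariance under a move. -/

section Shifted

variable {B W : Type*} [Group W] {M : CoxeterMatrix B} {cs : CoxeterSystem M W}

/-- Lengths add up in the product of `x` and the word `c`. -/
def IsReducedMul (cs : CoxeterSystem M W) (x : W) (c : List B) : Prop :=
  cs.length (x * cs.wordProd c) = cs.length x + c.length

theorem length_mul_wordProd_le (x : W) (c : List B) :
    cs.length (x * cs.wordProd c) ≤ cs.length x + c.length :=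
  (cs.length_mul_le _ _).trans (Nat.add_le_add_left (cs.length_wordProd_le c) _)

theorem IsReducedMul.append_iff {x : W} {c d : List B} :
    cs.IsReducedMul x (c ++ d) ↔
      cs.IsReducedMul x c ∧ cs.IsReducedMul (x * cs.wordProd c) d := by
  unfold IsReducedMul
  have h1 := length_mul_wordProd_le (cs := cs) x c
  have h2 := length_mul_wordProd_le (cs := cs) (x * cs.wordProd c) d
  rw [wordProd_append, ← mul_assoc, List.length_append]
  omega

theorem isReducedMul_nil (x : W) : cs.IsReducedMul x [] := by simp [IsReducedMul]

theorem isReducedMul_singleton {x : W} {s : B} :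
    cs.IsReducedMul x [s] ↔ ¬ cs.IsRightDescent x s := by
  simp [IsReducedMul, not_isRightDescent_iff]

theorem IsReducedMul.cons_iff {x : W} {s : B} {c : List B} :
    cs.IsReducedMul x (s :: c) ↔
      ¬ cs.IsRightDescent x s ∧ cs.IsReducedMul (x * cs.simple s) c := by
  rw [← List.singleton_append, append_iff, isReducedMul_singleton, wordProd_singleton]

theorem IsReducedMul.concat_iff {x : W} {s : B} {c : List B} :
    cs.IsReducedMul x (c ++ [s]) ↔
      cs.IsReducedMul x c ∧ ¬ cs.IsRightDescent (x * cs.wordProd c) s := by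
  rw [append_iff, isReducedMul_singleton]

/-- Multiplication by a word which is reduced after the larger element is monotone. -/
theorem IsReducedMul.mul_le_mul {x y : W} {c : List B} (h : cs.IsReducedMul y c)
    (hxy : cs.BruhatLE x y) :
    cs.BruhatLE (x * cs.wordProd c) (y * cs.wordProd c) := by
  induction c using List.reverseRecOn with
  | nil => simpa using hxy
  | append_singleton c s ih =>
    rw [concat_iff] at h
    simpa [wordProd_append, ← mul_assoc] using (ih h.1).mul_simple_mul_simple h.2

theorem IsReducedMul.simple_mul {r : B} {x : W} {c : List B} (h : cs.IsReducedMul x c)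
    (hr : cs.IsLeftDescent x r) : cs.IsReducedMul (cs.simple r * x) c := by
  have h1 := length_mul_wordProd_le (cs := cs) (cs.simple r * x) c
  have h2 := cs.length_simple_mul (x * cs.wordProd c) r
  rw [isLeftDescent_iff] at hr
  unfold IsReducedMul at *
  rw [mul_assoc] at *
  omega

theorem IsReducedMul.isLeftDescent {r : B} {x : W} {c : List B} (h : cs.IsReducedMul x c)
    (hr : cs.IsLeftDescent x r) : cs.IsLeftDescent (x * cs.wordProd c) r := by
  have h1 := length_mul_wordProd_le (cs := cs) (cs.simple r * x) c
  rw [isLeftDescent_iff] at hr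
  unfold IsReducedMul at h
  unfold IsLeftDescent
  rw [mul_assoc] at *
  omega

/-- The exchange property in the second factor. -/
theorem exists_exchange_right {r : B} {x : W} {c : List B} (h : ¬ cs.IsLeftDescent x r)
    (hc : cs.IsLeftDescent (x * cs.wordProd c) r) (hx : cs.IsReducedMul x c) :
    ∃ c₁ q c₂, c = c₁ ++ q :: c₂ ∧
      cs.simple r * x * cs.wordProd c₁ = x * cs.wordProd c₁ * cs.simple q := by
  induction c using List.reverseRecOn with
  | nil => simp at hc; exact absurd hc h
  | append_singleton c q ih =>
    rw [IsReducedMul.concat_iff] at hx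
    by_cases hc' : cs.IsLeftDescent (x * cs.wordProd c) r
    · obtain ⟨c₁, q', c₂, rfl, e⟩ := ih hc' hx.1
      exact ⟨c₁, q', c₂ ++ [q], by simp, e⟩
    · refine ⟨c, q, [], rfl, ?_⟩
      have h1 := (bruhatLE_simple_mul hc').mul_simple_le (s := q) ?_
      · rw [wordProd_append, wordProd_singleton, ← mul_assoc] at hc
        have h2 := hx.2
        rw [isLeftDescent_iff] at hc
        rw [not_isLeftDescent_iff] at hc'
        rw [not_isRightDescent_iff] at h2
        rw [mul_assoc]
        exact (h1.eq_of_length_le (by omega)).symm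
      · have h2 := hx.2
        rw [wordProd_append, wordProd_singleton, ← mul_assoc] at hc
        rw [isLeftDescent_iff, ← mul_assoc] at hc
        rw [not_isLeftDescent_iff] at hc'
        rw [not_isRightDescent_iff] at h2
        rw [IsRightDescent]
        omega

/-- No position of `c` is a shifted descent, when `z` and `v` are the elements reached before `c`
by the two products. -/
def NoShiftedDescent (cs : CoxeterSystem M W) (v z : W) (c : List B) : Prop :=
  ∀ c₁ q c₂, c = c₁ ++ q :: c₂ →
    ¬ cs.BruhatLE (v * cs.wordProd c₁ * cs.simple q) (z * cs.wordProd c₁)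

theorem NoShiftedDescent.append {v z : W} {c d : List B}
    (h : cs.NoShiftedDescent v z (c ++ d)) : cs.NoShiftedDescent v z c := by
  rintro c₁ q c₂ rfl
  exact h c₁ q (c₂ ++ d) (by simp)

theorem NoShiftedDescent.concat_iff {v z : W} {c : List B} {q : B} :
    cs.NoShiftedDescent v z (c ++ [q]) ↔ cs.NoShiftedDescent v z c ∧
      ¬ cs.BruhatLE (v * cs.wordProd c * cs.simple q) (z * cs.wordProd c) := by
  refine ⟨fun h => ⟨h.append, h c q [] rfl⟩, fun h c₁ q' c₂ e => ?_⟩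
  rcases List.eq_nil_or_concat c₂ with rfl | ⟨c₂', q'', rfl⟩
  · obtain ⟨rfl, e⟩ := List.append_inj' e rfl
    obtain rfl : q = q' := by simpa using e
    exact h.2
  · rw [List.concat_eq_append, ← List.cons_append, ← List.append_assoc] at e
    exact h.1 c₁ q' c₂' (List.append_inj' e rfl).1

theorem noShiftedDescent_nil (v z : W) : cs.NoShiftedDescent v z [] := by
  rintro c₁ q c₂ e; simp at e

/-- If some letter `q` lowered the product starting from `z`, lifting would put the product from
`v`, already multiplied by `q`, below it, making `q` a shifted descent. -/
theorem NoShiftedDescent.isReducedMul {v z : W} {c : List B} (h : cs.NoShiftedDescent v z c)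
    (hvz : cs.BruhatLE v z) (hv : cs.IsReducedMul v c) : cs.IsReducedMul z c := by
  induction c using List.reverseRecOn with
  | nil => exact isReducedMul_nil z
  | append_singleton c q ih =>
    rw [concat_iff] at h
    rw [IsReducedMul.concat_iff] at hv ⊢
    have hz := ih h.1 hv.1
    refine ⟨hz, fun hd => h.2 ?_⟩
    have h1 := hz.mul_le_mul hvz
    simpa using h1.mul_simple_le hd

/-- The hard case of the invariance. The induction is on the length of `a`: a left descent `r` of
`a` is removed, and the cases are whether `r` is a left descent of `v` and of `u * t`. Either the
hypotheses survive the removal, or `u` is identified with an element known to lie below `a`, or a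
shifted descent appears in `c`. -/
theorem le_of_noShiftedDescent {c : List B} {s t : B} (n : ℕ) {a u v : W}
    (hn : cs.length a = n)
    (huv : u * cs.wordProd c = v * cs.wordProd c * cs.simple s)
    (hva : cs.BruhatLE v a) (hua : cs.BruhatLE (u * cs.simple t) a)
    (hut : cs.IsRightDescent u t) (hvt : cs.IsRightDescent v t)
    (hvu : cs.BruhatLE v u) (hl : cs.length u = cs.length v + 1)
    (hv : cs.IsReducedMul v (c ++ [s])) (hu : cs.IsReducedMul u c)
    (ha : cs.IsReducedMul a (t :: c))
    (hc : cs.NoShiftedDescent v (a * cs.simple t) c) :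
    cs.BruhatLE u a := by
  induction n generalizing a u v with
  | zero =>
    have := hva.length_le
    unfold IsRightDescent at hvt
    omega
  | succ n ih =>
    have ha1 : a ≠ 1 := by rintro rfl; simp at hn
    obtain ⟨r, hr⟩ := cs.exists_leftDescent_of_ne_one ha1
    have hra := simple_mul_bruhatLE hr
    have hrn : cs.length (cs.simple r * a) = n := by
      rw [isLeftDescent_iff] at hr; omega
    have ha' : cs.IsReducedMul (cs.simple r * a) (t :: c) := ha.simple_mul hr
    have hat := (IsReducedMul.cons_iff.mp ha).1
    have hatr : cs.IsLeftDescent (a * cs.simple t) r := by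
      simpa using (isReducedMul_singleton.mpr hat).isLeftDescent hr
    have hatc := (IsReducedMul.cons_iff.mp ha).2
    have lut := cs.isRightDescent_iff.mp hut
    have lvt := cs.isRightDescent_iff.mp hvt
    have hcr : ∀ c₁, c₁ <+: c → cs.IsLeftDescent (a * cs.simple t * cs.wordProd c₁) r := by
      rintro c₁ ⟨c₂, rfl⟩
      exact (IsReducedMul.append_iff.mp hatc).1.isLeftDescent hatr
    have hru_of (h : cs.IsLeftDescent (u * cs.simple t) r) : cs.IsLeftDescent u r := by
      have h1 : ¬ cs.IsRightDescent (u * cs.simple t) t :=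
        cs.isRightDescent_iff_not_isRightDescent_mul.mp hut
      simpa using (isReducedMul_singleton.mpr h1).isLeftDescent h
    have hvut := hvu.mul_simple_mul_simple_of_isRightDescent hvt
    have hru_eq (h : cs.IsLeftDescent (u * cs.simple t) r)
        (h' : ¬ cs.IsLeftDescent (v * cs.simple t) r) : cs.simple r * v = u := by
      have h1 := hvut.simple_mul_le h
      rw [not_isLeftDescent_iff] at h'
      have h2 := h1.eq_of_length_le (by omega)
      rwa [← mul_assoc, mul_left_inj] at h2
    by_cases hrv : cs.IsLeftDescent v r
    · have hva' := hva.simple_mul_simple_mul_of_isLeftDescent hrv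
      have lrv := cs.isLeftDescent_iff.mp hrv
      by_cases hrut : cs.IsLeftDescent (u * cs.simple t) r
      · have hru := hru_of hrut
        have lru := cs.isLeftDescent_iff.mp hru
        have lrut := cs.isLeftDescent_iff.mp hrut
        -- If `r` were not a left descent of `v * t`, `hru_eq` would give `r * v = u`, which is too
        -- long because `r` lowers `v`.
        have hrvt : cs.IsRightDescent (cs.simple r * v) t := by
          by_cases h' : cs.IsLeftDescent (v * cs.simple t) r
          · rw [isLeftDescent_iff, ← mul_assoc] at h'
            rw [IsRightDescent]
            omega
          · have := hru_eq hrut h'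
            rw [this] at lrv
            omega
        have hrut' : cs.IsRightDescent (cs.simple r * u) t := by
          rw [IsRightDescent, mul_assoc]; omega
        have h := ih hrn (by simp [mul_assoc, huv]) hva'
          (by simpa [mul_assoc] using hua.simple_mul_simple_mul_of_isLeftDescent hrut)
          hrut' hrvt (hvu.simple_mul_simple_mul_of_isLeftDescent hrv) (by omega)
          (hv.simple_mul hrv) (hu.simple_mul hru) ha' ?_
        · simpa using h.simple_mul_simple_mul (cs.isLeftDescent_iff_not_isLeftDescent_mul.mp hr)
        · rintro c₁ q c₂ rfl hle
          refine hc c₁ q c₂ rfl ?_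
          have h1 := cs.isLeftDescent_iff_not_isLeftDescent_mul.mp
            (hcr c₁ (List.prefix_append _ _))
          simpa [mul_assoc] using BruhatLE.simple_mul_simple_mul
            (x := cs.simple r * v * cs.wordProd c₁ * cs.simple q) (by simpa [mul_assoc] using hle) h1
      · have hua' := (hua.le_simple_mul hrut).simple_mul_simple_mul
          (cs.isLeftDescent_iff_not_isLeftDescent_mul.mp hr)
        rw [simple_mul_simple_cancel_left] at hua'
        have lrut := cs.not_isLeftDescent_iff.mp hrut
        by_cases hru : cs.IsLeftDescent u r
        · have lru := cs.isLeftDescent_iff.mp hru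
          -- Here `u * t ≤ r * u` with equal lengths, so `u = r * u * t`, which `hua'` bounds by
          -- `a`.
          have h1 := (mul_simple_bruhatLE hut).le_simple_mul hrut
          have h2 := h1.eq_of_length_le (by omega)
          rwa [h2, simple_mul_simple_cancel_left] at hua'
        · exfalso
          have h1 : cs.IsLeftDescent (u * cs.wordProd c) r := by
            -- Since `u * c = v * c * s` and lengths add in the latter, the left descent `r` of `v`
            -- becomes one of `u * c`. Exchange then yields `v * c₁ * q ≤ u * c₁ * q = r * u * c₁ ≤
            -- a * t * c₁`, a shifted descent.
            have := hv.isLeftDescent hrv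
            rwa [wordProd_append, wordProd_singleton, ← mul_assoc, ← huv] at this
          obtain ⟨c₁, q, c₂, rfl, e⟩ := exists_exchange_right hru h1 hu
          refine hc c₁ q c₂ rfl ?_
          have h2 := hua'.mul_simple_mul_simple hat
          have h3 := (IsReducedMul.append_iff.mp hatc).1.mul_le_mul h2
          rw [← mul_assoc, simple_mul_simple_cancel_right, e] at h3
          have h4 := (IsReducedMul.append_iff (d := c₂) (c := c₁ ++ [q])).mp (by simpa using hu)
          have h5 := h4.1.mul_le_mul hvu
          rw [wordProd_append, wordProd_singleton, ← mul_assoc, ← mul_assoc] at h5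
          exact h5.trans h3
    · have hva' := hva.le_simple_mul (s := r) hrv
      by_cases hrut : cs.IsLeftDescent (u * cs.simple t) r
      · have hvt' : ¬ cs.IsLeftDescent (v * cs.simple t) r := fun h' => by
          rw [isLeftDescent_iff, ← mul_assoc] at h'
          rw [not_isLeftDescent_iff] at hrv
          have := cs.length_le_length_mul_add_right (cs.simple r * v) (cs.simple t)
          rw [length_simple] at this
          omega
        rw [← hru_eq hrut hvt']
        exact hva.simple_mul_le hr
      · have hua' := hua.le_simple_mul (s := r) hrut
        refine (ih hrn huv hva' hua' hut hvt hvu hl hv hu ha' ?_).trans hra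
        rintro c₁ q c₂ rfl hle
        refine hc c₁ q c₂ rfl (hle.trans ?_)
        simpa [mul_assoc] using simple_mul_bruhatLE (hcr c₁ (List.prefix_append _ _))

/-- The letters of `c` can be stripped from the right of `x`: if the last letter `q` were not a
descent of `x`, lifting would place `x`, and so `v * c`, below the product from `z` before `q`, a
shifted descent. -/
theorem exists_mul_wordProd_eq {c : List B} {v z x : W}
    (hv : cs.IsReducedMul v c) (hx : cs.BruhatLE x (z * cs.wordProd c))
    (hvx : cs.BruhatLE (v * cs.wordProd c) x)
    (hz : cs.IsReducedMul z c) (hc : cs.NoShiftedDescent v z c) :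
    ∃ u, u * cs.wordProd c = x ∧ cs.IsReducedMul u c ∧ cs.BruhatLE v u ∧ cs.BruhatLE u z := by
  induction c using List.reverseRecOn generalizing x with
  | nil => exact ⟨x, by simp, isReducedMul_nil x, by simpa using hvx, by simpa using hx⟩
  | append_singleton c q ih =>
    rw [NoShiftedDescent.concat_iff] at hc
    rw [IsReducedMul.concat_iff] at hv hz
    rw [wordProd_append, wordProd_singleton, ← mul_assoc] at hx hvx
    have hxq : cs.IsRightDescent x q := by
      by_contra hcon
      refine hc.2 (hvx.trans ?_)
      simpa using hx.le_mul_simple hcon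
    have hvq : cs.IsRightDescent (v * cs.wordProd c * cs.simple q) q := by
      rw [isRightDescent_iff_not_isRightDescent_mul, simple_mul_simple_cancel_right]
      exact hv.2
    obtain ⟨u, h1, h2, h3, h4⟩ := ih (x := x * cs.simple q) hv.1
      (by simpa using hx.mul_simple_mul_simple_of_isRightDescent hxq)
      (by simpa using hvx.mul_simple_mul_simple_of_isRightDescent hvq) hz.1 hc.1
    refine ⟨u, by simp [wordProd_append, ← mul_assoc, h1], ?_, h3, h4⟩
    rw [IsReducedMul.concat_iff, h1]
    exact ⟨h2, cs.isRightDescent_iff_not_isRightDescent_mul.mp hxq⟩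

/-- If `a < a t` have no shifted descents along `c`, the following letter is a shifted descent for
both of them or for none. -/
theorem mul_simple_le_iff_of_noShiftedDescent {a v : W} {s t : B} {c : List B}
    (hva : cs.BruhatLE v a) (hat : ¬ cs.IsRightDescent a t)
    (htc : cs.IsReduced (t :: c ++ [s])) (hv : cs.IsReducedMul v (c ++ [s]))
    (ha : cs.NoShiftedDescent v a c) (hat' : cs.NoShiftedDescent v (a * cs.simple t) c) :
    cs.BruhatLE (v * cs.wordProd c * cs.simple s) (a * cs.wordProd c) ↔
      cs.BruhatLE (v * cs.wordProd c * cs.simple s) (a * cs.simple t * cs.wordProd c) := by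
  have hv' := IsReducedMul.concat_iff.mp hv
  have hac := ha.isReducedMul hva hv'.1
  have hatc := hat'.isReducedMul (hva.mul_simple_of_not_isRightDescent hat) hv'.1
  refine ⟨fun h => h.trans (hatc.mul_le_mul (bruhatLE_mul_simple hat)), fun h => ?_⟩
  -- The element `u` satisfies `u * c = v * c * s` and `v ≤ u ≤ a * t`, so it suffices to prove `u ≤
  -- a`. This is lifting unless `t` is a right descent of `u`.
  obtain ⟨u, h1, h2, h3, h4⟩ := exists_mul_wordProd_eq hv'.1 h (bruhatLE_mul_simple hv'.2) hatc hat'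
  rw [← h1]
  refine hac.mul_le_mul ?_
  have hl : cs.length u = cs.length v + 1 := by
    have e1 := hv'.1
    have e2 := cs.not_isRightDescent_iff.mp hv'.2
    unfold IsReducedMul at h2 e1
    rw [h1] at h2
    omega
  by_cases hut : cs.IsRightDescent u t
  · have hua : cs.BruhatLE (u * cs.simple t) a := by
      simpa using h4.mul_simple_mul_simple_of_isRightDescent hut
    by_cases hvt : cs.IsRightDescent v t
    · exact le_of_noShiftedDescent _ rfl h1 hva hua hut hvt h3 hl hv h2
        (IsReducedMul.cons_iff.mpr ⟨hat, hatc⟩) hat'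
    -- Now `u = v * t`, hence `t * c = c * s` in `W`, contrary to `t :: c ++ [s]` being reduced.
    · exfalso
      have e1 := h3.le_mul_simple hvt
      have e2 := cs.isRightDescent_iff.mp hut
      have e3 := e1.eq_of_length_le (by omega)
      have e4 : u = v * cs.simple t := by rw [e3]; simp
      rw [e4, mul_assoc, mul_assoc, mul_right_inj] at h1
      have e5 := htc.eq
      rw [wordProd_append, wordProd_cons, h1, wordProd_singleton,
        simple_mul_simple_cancel_right] at e5
      have := cs.length_wordProd_le c
      simp at e5
      omega
  · simpa using h4.le_mul_simple hut

/-- This makes the matching symmetric: after a move at `t`, the rightmost move is still at `t`. -/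
theorem noShiftedDescent_mul_simple_iff {a v : W} {t : B} {c : List B}
    (hva : cs.BruhatLE v a) (hva' : cs.BruhatLE v (a * cs.simple t))
    (htc : cs.IsReduced (t :: c)) (hv : cs.IsReducedMul v c) :
    cs.NoShiftedDescent v a c ↔ cs.NoShiftedDescent v (a * cs.simple t) c := by
  induction c using List.reverseRecOn with
  | nil => simp [noShiftedDescent_nil]
  | append_singleton c s ih =>
    have htc' := (cs.isReduced_append_singleton (ω := t :: c) htc).1
    rw [NoShiftedDescent.concat_iff, NoShiftedDescent.concat_iff,
      ih htc' (IsReducedMul.concat_iff.mp hv).1]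
    refine and_congr_right fun h => not_congr ?_
    have h' := (ih htc' (IsReducedMul.concat_iff.mp hv).1).mpr h
    by_cases hat : cs.IsRightDescent a t
    · rw [isRightDescent_iff_not_isRightDescent_mul] at hat
      simpa using (mul_simple_le_iff_of_noShiftedDescent hva' hat htc hv h (by simpa using h')).symm
    · exact mul_simple_le_iff_of_noShiftedDescent hva hat htc hv h' h

end Shifted

end CoxeterSystem

/-! ### Bookkeeping for subexpressions and combined masks. -/

theorem subexpression_append {B : Type*} {ω ω' : List B} {σ σ' : List Bool}
    (h : σ.length = ω.length) :
    subexpression (ω ++ ω') (σ ++ σ') = subexpression ω σ ++ subexpression ω' σ' := by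
  induction ω generalizing σ with
  | nil => rw [List.length_eq_zero_iff.mp h]; simp [subexpression]
  | cons i ω ih =>
    obtain ⟨b, σ, rfl⟩ := List.exists_cons_of_length_eq_add_one h
    cases b <;> simp [subexpression, ih (σ := σ) (by simpa using h)]

theorem length_subexpression {B : Type*} {ω : List B} {σ : List Bool}
    (h : σ.length = ω.length) : (subexpression ω σ).length = σ.count true := by
  induction ω generalizing σ with
  | nil => rw [List.length_eq_zero_iff.mp h]; simp [subexpression]
  | cons i ω ih =>
    obtain ⟨b, σ, rfl⟩ := List.exists_cons_of_length_eq_add_one h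
    cases b <;> simp [subexpression, ih (σ := σ) (by simpa using h)]

theorem subexpression_sublist {B : Type*} (ω : List B) (σ : List Bool) :
    (subexpression ω σ).Sublist ω := by
  induction ω generalizing σ with
  | nil => cases σ <;> simp [subexpression]
  | cons i ω ih =>
    rcases σ with _ | ⟨_ | _, σ⟩
    · simp [subexpression]
    · exact (ih σ).cons i
    · exact (ih σ).cons_cons i

theorem combineMasks_append {τ τ' ν ν' : List Bool} (h : ν.length = τ.count true) :
    combineMasks (τ ++ τ') (ν ++ ν') = combineMasks τ ν ++ combineMasks τ' ν' := by
  induction τ generalizing ν with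
  | nil =>
    rw [List.count_nil, List.length_eq_zero_iff] at h
    simp [h, combineMasks]
  | cons b τ ih =>
    cases b
    · simp [combineMasks, ih (ν := ν) (by simpa using h)]
    · rw [List.count_cons_self] at h
      obtain ⟨b, ν, rfl⟩ := List.exists_cons_of_length_eq_add_one h
      cases b <;> simp [combineMasks, ih (ν := ν) (by simpa using h)]

theorem xMask_combineMasks {τ ν : List Bool} (h : ν.length = τ.count true) :
    xMask (combineMasks τ ν) = τ := by
  induction τ generalizing ν with
  | nil => simp [combineMasks, xMask]
  | cons b τ ih =>
    unfold xMask at ih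
    cases b
    · simp [combineMasks, xMask, ih (ν := ν) (by simpa using h)]
    · rw [List.count_cons_self] at h
      obtain ⟨b, ν, rfl⟩ := List.exists_cons_of_length_eq_add_one h
      cases b <;> simp [combineMasks, xMask, ih (ν := ν) (by simpa using h)]

theorem subexpression_oneMask_combineMasks {B : Type*} {ω : List B} {τ ν : List Bool}
    (hτ : τ.length = ω.length) (h : ν.length = τ.count true) :
    subexpression ω (oneMask (combineMasks τ ν)) = subexpression (subexpression ω τ) ν := by
  induction τ generalizing ν ω with
  | nil =>
    rw [List.count_nil, List.length_eq_zero_iff] at h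
    rw [List.length_nil, eq_comm, List.length_eq_zero_iff] at hτ
    simp [h, hτ, oneMask, combineMasks, subexpression]
  | cons b τ ih =>
    unfold oneMask at ih
    obtain ⟨i, ω, rfl⟩ := List.exists_cons_of_length_eq_add_one hτ.symm
    cases b
    · simp [combineMasks, oneMask, subexpression,
        ih (ν := ν) (ω := ω) (by simpa using hτ) (by simpa using h)]
    · rw [List.count_cons_self] at h
      obtain ⟨b, ν, rfl⟩ := List.exists_cons_of_length_eq_add_one h
      cases b <;> simp [combineMasks, oneMask, subexpression,
        ih (ν := ν) (ω := ω) (by simpa using hτ) (by simpa using h)]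

@[simp] theorem length_xMask (σ : List MaskEntry) : (xMask σ).length = σ.length := by
  simp [xMask]

@[simp] theorem length_oneMask (σ : List MaskEntry) : (oneMask σ).length = σ.length := by
  simp [oneMask]

@[simp] theorem xMask_append (σ σ' : List MaskEntry) :
    xMask (σ ++ σ') = xMask σ ++ xMask σ' := by simp [xMask]

@[simp] theorem oneMask_append (σ σ' : List MaskEntry) :
    oneMask (σ ++ σ') = oneMask σ ++ oneMask σ' := by simp [oneMask]

namespace CoxeterSystem

/-! ### Constant masks, built from the right. -/

section ConstantMasks

variable {B W : Type*} [Group W] {M : CoxeterMatrix B} {cs : CoxeterSystem M W}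

theorem initialProd_append {ω ω' : List B} {σ σ' : List Bool} {j : ℕ}
    (h : σ.length = ω.length) (hj : j ≤ ω.length) :
    cs.initialProd (ω ++ ω') (σ ++ σ') j = cs.initialProd ω σ j := by
  rw [initialProd, List.take_append_of_le_length hj, List.take_append_of_le_length (h ▸ hj),
    initialProd]

theorem initialProd_length {ω : List B} {σ : List Bool} (h : σ.length = ω.length) :
    cs.initialProd ω σ ω.length = cs.wordProd (subexpression ω σ) := by
  rw [initialProd, List.take_length, ← h, List.take_length]

theorem isDefect_append {ω ω' : List B} {σ σ' : List Bool} {j : ℕ}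
    (h : σ.length = ω.length) (hj : j < ω.length) :
    cs.IsDefect (ω ++ ω') (σ ++ σ') j ↔ cs.IsDefect ω σ j := by
  unfold IsDefect
  rw [initialProd_append h hj.le, List.getElem?_append_left hj]

theorem isDefect_length {ω ω' : List B} {σ σ' : List Bool} {s : B} (h : σ.length = ω.length) :
    cs.IsDefect (ω ++ s :: ω') (σ ++ σ') ω.length ↔
      cs.IsRightDescent (cs.wordProd (subexpression ω σ)) s := by
  unfold IsDefect
  rw [initialProd_append h le_rfl, initialProd_length h]
  simp [bruhatLT_mul_simple_iff]

/-- Having no defect at the end means that `s` raises the product of the earlier selected letters;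
so the last letter is selected exactly when it is a right descent of `x`. Existence and uniqueness
of constant masks follow by recursion. -/
theorem isConstantMask_concat {ω : List B} {s : B} {x : W} {τ : List Bool} {b : Bool} :
    cs.IsConstantMask (ω ++ [s]) x (τ ++ [b]) ↔
      (b = false ∧ ¬ cs.IsRightDescent x s ∧ cs.IsConstantMask ω x τ) ∨
      (b = true ∧ cs.IsRightDescent x s ∧ cs.IsConstantMask ω (x * cs.simple s) τ) := by
  by_cases h : τ.length = ω.length
  swap
  · constructor
    · exact fun h' => absurd h'.1 (by simpa using h)
    · rintro (h' | h') <;> exact absurd h'.2.2.1 h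
  have hd : (∀ j, ¬ cs.IsDefect (ω ++ [s]) (τ ++ [b]) j) ↔ (∀ j, ¬ cs.IsDefect ω τ j) ∧
      ¬ cs.IsRightDescent (cs.wordProd (subexpression ω τ)) s := by
    rw [← isDefect_length (ω' := []) (σ' := [b]) h]
    refine ⟨fun h' => ⟨fun j hj => ?_, h' _⟩, fun h' j hj => ?_⟩
    · have hjl : j < ω.length := by
        obtain ⟨i, hi, -⟩ := hj
        exact (List.getElem?_eq_some_iff.mp hi).1
      exact h' j ((isDefect_append h hjl).mpr hj)
    · have hjl : j < (ω ++ [s]).length := by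
        obtain ⟨i, hi, -⟩ := hj
        exact (List.getElem?_eq_some_iff.mp hi).1
      rcases (show j ≤ ω.length by simp at hjl; omega).lt_or_eq with hlt | rfl
      · exact h'.1 j ((isDefect_append h hlt).mp hj)
      · exact h'.2 hj
  unfold IsConstantMask
  rw [hd, subexpression_append h, wordProd_append]
  cases b
  · simp only [List.length_append, List.length_singleton, subexpression, wordProd_nil, mul_one,
      h, true_and, reduceCtorEq, false_and, or_false]
    constructor
    · rintro ⟨rfl, h1, h2⟩; exact ⟨h2, rfl, h1⟩
    · rintro ⟨h2, rfl, h1⟩; exact ⟨rfl, h1, h2⟩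
  · simp only [List.length_append, List.length_singleton, subexpression, wordProd_singleton,
      h, true_and, reduceCtorEq, false_and, false_or]
    constructor
    · rintro ⟨rfl, h1, h2⟩
      refine ⟨?_, by simp, h1⟩
      rwa [isRightDescent_iff_not_isRightDescent_mul, simple_mul_simple_cancel_right]
    · rintro ⟨h2, h3, h1⟩
      rw [h3, ← isRightDescent_iff_not_isRightDescent_mul]
      exact ⟨simple_mul_simple_cancel_right _ _, h1, h2⟩

theorem isConstantMask_nil {x : W} {τ : List Bool} :
    cs.IsConstantMask [] x τ ↔ x = 1 ∧ τ = [] := by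
  constructor
  · rintro ⟨h1, h2, -⟩
    obtain rfl : τ = [] := by simpa using h1
    exact ⟨by simpa [subexpression] using h2.symm, rfl⟩
  · rintro ⟨rfl, rfl⟩
    exact ⟨rfl, by simp [subexpression], fun j ⟨i, hi, _⟩ => by simp at hi⟩

theorem IsConstantMask.exists_concat {ω : List B} {s : B} {x : W} {τ : List Bool}
    (h : cs.IsConstantMask (ω ++ [s]) x τ) : ∃ τ' b, τ = τ' ++ [b] := by
  have h1 : τ ≠ [] := by rintro rfl; simpa using h.1
  exact ⟨_, _, (List.dropLast_append_getLast h1).symm⟩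

theorem IsConstantMask.unique {ω : List B} {x : W} {τ τ' : List Bool}
    (h : cs.IsConstantMask ω x τ) (h' : cs.IsConstantMask ω x τ') : τ = τ' := by
  induction ω using List.reverseRecOn generalizing x τ τ' with
  | nil => rw [(isConstantMask_nil.mp h).2, (isConstantMask_nil.mp h').2]
  | append_singleton ω s ih =>
    obtain ⟨τ, b, rfl⟩ := h.exists_concat
    obtain ⟨τ', b', rfl⟩ := h'.exists_concat
    rw [isConstantMask_concat] at h h'
    rcases h with ⟨rfl, h1, h2⟩ | ⟨rfl, h1, h2⟩ <;> rcases h' with ⟨rfl, h3, h4⟩ | ⟨rfl, h3, h4⟩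
    · rw [ih h2 h4]
    · exact absurd h3 h1
    · exact absurd h1 h3
    · rw [ih h2 h4]

theorem IsConstantMask.isReduced {ω : List B} {x : W} {τ : List Bool}
    (h : cs.IsConstantMask ω x τ) : cs.IsReduced (subexpression ω τ) := by
  induction ω using List.reverseRecOn generalizing x τ with
  | nil => rw [(isConstantMask_nil.mp h).2]; simp [subexpression, IsReduced]
  | append_singleton ω s ih =>
    obtain ⟨τ, b, rfl⟩ := h.exists_concat
    rw [subexpression_append (by simpa using h.1)]
    rw [isConstantMask_concat] at h
    rcases h with ⟨rfl, -, h2⟩ | ⟨rfl, h1, h2⟩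
    · simpa [subexpression] using ih h2
    · have h3 := (ih h2).eq
      have h4 : subexpression [s] [true] = [s] := by simp [subexpression]
      rw [h4, IsReduced, wordProd_append, wordProd_singleton, List.length_append, ← h3, h2.2.1,
        simple_mul_simple_cancel_right]
      exact (cs.isRightDescent_iff.mp h1).symm

theorem exists_isConstantMask {ω : List B} {x : W} (hω : cs.IsReduced ω)
    (h : cs.BruhatLE x (cs.wordProd ω)) : ∃ τ, cs.IsConstantMask ω x τ := by
  induction ω using List.reverseRecOn generalizing x with
  | nil => exact ⟨[], isConstantMask_nil.mpr ⟨h.eq_of_length_le (by simp), rfl⟩⟩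
  | append_singleton ω s ih =>
    have hω' := cs.isReduced_append_singleton hω
    rw [wordProd_append, wordProd_singleton] at h
    by_cases hx : cs.IsRightDescent x s
    · obtain ⟨τ, hτ⟩ := ih hω'.1
        (by simpa using h.mul_simple_mul_simple_of_isRightDescent hx)
      exact ⟨τ ++ [true], isConstantMask_concat.mpr (Or.inr ⟨rfl, hx, hτ⟩)⟩
    · obtain ⟨τ, hτ⟩ := ih hω'.1 (by simpa using h.le_mul_simple hx)
      exact ⟨τ ++ [false], isConstantMask_concat.mpr (Or.inl ⟨rfl, hx, hτ⟩)⟩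

theorem isConstantMask_constantMask {ω : List B} {x : W} (hω : cs.IsReduced ω)
    (h : cs.BruhatLE x (cs.wordProd ω)) : cs.IsConstantMask ω x (cs.constantMask ω x) :=
  Classical.epsilon_spec (exists_isConstantMask hω h)

end ConstantMasks

/-! ### Relative masks, built from the right. -/

section RelativeMasks

variable {B W : Type*} [Group W] {M : CoxeterMatrix B} {cs : CoxeterSystem M W}

theorem IsConstantMask.length_eq_count {ω : List B} {y : W} {τ ν : List Bool}
    (hτ : τ.length = ω.length) (hν : cs.IsConstantMask (subexpression ω τ) y ν) :
    ν.length = τ.count true := by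
  rw [hν.1, length_subexpression hτ]

theorem IsRelativeMask.isConstantMask_xMask {ω : List B} {y x : W} {σ : List MaskEntry}
    (h : cs.IsRelativeMask ω y x σ) : cs.IsConstantMask ω x (xMask σ) := by
  obtain ⟨τ, ν, hτ, hν, rfl⟩ := h
  rwa [xMask_combineMasks (hν.length_eq_count hτ.1)]

theorem IsRelativeMask.wordProd_oneMask {ω : List B} {y x : W} {σ : List MaskEntry}
    (h : cs.IsRelativeMask ω y x σ) : cs.wordProd (subexpression ω (oneMask σ)) = y := by
  obtain ⟨τ, ν, hτ, hν, rfl⟩ := h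
  rw [subexpression_oneMask_combineMasks hτ.1 (hν.length_eq_count hτ.1), hν.2.1]

theorem IsRelativeMask.wordProd_xMask {ω : List B} {y x : W} {σ : List MaskEntry}
    (h : cs.IsRelativeMask ω y x σ) : cs.wordProd (subexpression ω (xMask σ)) = x :=
  h.isConstantMask_xMask.2.1

theorem IsRelativeMask.length_eq {ω : List B} {y x : W} {σ : List MaskEntry}
    (h : cs.IsRelativeMask ω y x σ) : σ.length = ω.length := by
  simpa using h.isConstantMask_xMask.1

theorem IsRelativeMask.le {ω : List B} {y x : W} {σ : List MaskEntry}
    (h : cs.IsRelativeMask ω y x σ) : cs.BruhatLE y x := by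
  obtain ⟨τ, ν, hτ, hν, rfl⟩ := h
  rw [← hτ.2.1, ← hν.2.1]
  exact cs.bruhatLE_of_sublist hτ.isReduced (subexpression_sublist _ _)

theorem IsRelativeMask.unique {ω : List B} {y x : W} {σ σ' : List MaskEntry}
    (h : cs.IsRelativeMask ω y x σ) (h' : cs.IsRelativeMask ω y x σ') : σ = σ' := by
  obtain ⟨τ, ν, hτ, hν, rfl⟩ := h
  obtain ⟨τ', ν', hτ', hν', rfl⟩ := h'
  obtain rfl := hτ.unique hτ'
  rw [hν.unique hν']

theorem exists_isRelativeMask {ω : List B} {y x : W} (hω : cs.IsReduced ω)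
    (hx : cs.BruhatLE x (cs.wordProd ω)) (hyx : cs.BruhatLE y x) :
    ∃ σ, cs.IsRelativeMask ω y x σ := by
  obtain ⟨τ, hτ⟩ := exists_isConstantMask hω hx
  obtain ⟨ν, hν⟩ := exists_isConstantMask hτ.isReduced (hτ.2.1 ▸ hyx)
  exact ⟨_, τ, ν, hτ, hν, rfl⟩

theorem isRelativeMask_concat {ω : List B} {s : B} {y x : W} {σ : List MaskEntry}
    {e : MaskEntry} :
    cs.IsRelativeMask (ω ++ [s]) y x (σ ++ [e]) ↔
      (e = MaskEntry.X ∧ ¬ cs.IsRightDescent x s ∧ cs.IsRelativeMask ω y x σ) ∨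
      (e = MaskEntry.zero ∧ cs.IsRightDescent x s ∧ ¬ cs.IsRightDescent y s ∧
        cs.IsRelativeMask ω y (x * cs.simple s) σ) ∨
      (e = MaskEntry.one ∧ cs.IsRightDescent x s ∧ cs.IsRightDescent y s ∧
        cs.IsRelativeMask ω (y * cs.simple s) (x * cs.simple s) σ) := by
  constructor
  · rintro ⟨τ, ν, hτ, hν, e1⟩
    obtain ⟨τ, b, rfl⟩ := hτ.exists_concat
    have hl : τ.length = ω.length := by simpa using hτ.1
    rw [subexpression_append hl] at hν
    rw [isConstantMask_concat] at hτ
    rcases hτ with ⟨rfl, h1, h2⟩ | ⟨rfl, h1, h2⟩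
    · have hν' : cs.IsConstantMask (subexpression ω τ) y ν := by
        simpa [subexpression] using hν
      have e2 := combineMasks_append (τ' := [false]) (ν' := []) (hν'.length_eq_count hl)
      rw [List.append_nil] at e2
      rw [e2] at e1
      obtain ⟨rfl, e3⟩ := List.append_inj' e1 (by simp [combineMasks])
      exact Or.inl ⟨by simpa [combineMasks] using e3, h1, τ, ν, h2, hν', rfl⟩
    · have hν' : cs.IsConstantMask (subexpression ω τ ++ [s]) y ν := by
        simpa [subexpression] using hν
      obtain ⟨ν, b, rfl⟩ := hν'.exists_concat
      rw [isConstantMask_concat] at hν'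
      have hlν : ν.length = τ.count true := by
        rcases hν' with h | h <;> exact h.2.2.length_eq_count hl
      rw [combineMasks_append hlν] at e1
      rcases hν' with ⟨rfl, h3, h4⟩ | ⟨rfl, h3, h4⟩ <;>
        obtain ⟨rfl, e3⟩ := List.append_inj' e1 (by simp [combineMasks])
      · exact Or.inr (Or.inl ⟨by simpa [combineMasks] using e3, h1, h3, τ, ν, h2, h4, rfl⟩)
      · exact Or.inr (Or.inr ⟨by simpa [combineMasks] using e3, h1, h3, τ, ν, h2, h4, rfl⟩)
  · rintro (⟨rfl, h1, τ, ν, h2, h3, rfl⟩ | ⟨rfl, h1, h4, τ, ν, h2, h3, rfl⟩ |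
      ⟨rfl, h1, h4, τ, ν, h2, h3, rfl⟩)
    · refine ⟨τ ++ [false], ν, isConstantMask_concat.mpr (Or.inl ⟨rfl, h1, h2⟩), ?_, ?_⟩
      · rw [subexpression_append h2.1]
        simpa [subexpression] using h3
      · have e2 := combineMasks_append (τ' := [false]) (ν' := []) (h3.length_eq_count h2.1)
        rw [List.append_nil] at e2
        rw [e2]
        simp [combineMasks]
    · refine ⟨τ ++ [true], ν ++ [false], isConstantMask_concat.mpr (Or.inr ⟨rfl, h1, h2⟩), ?_, ?_⟩
      · rw [subexpression_append h2.1]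
        exact isConstantMask_concat.mpr (Or.inl ⟨rfl, h4, h3⟩)
      · rw [combineMasks_append (h3.length_eq_count h2.1)]
        simp [combineMasks]
    · refine ⟨τ ++ [true], ν ++ [true], isConstantMask_concat.mpr (Or.inr ⟨rfl, h1, h2⟩), ?_, ?_⟩
      · rw [subexpression_append h2.1]
        exact isConstantMask_concat.mpr (Or.inr ⟨rfl, h4, h3⟩)
      · rw [combineMasks_append (h3.length_eq_count h2.1)]
        simp [combineMasks]

/-- When both products grow along `c`, every letter of `c` is a descent of both elements reached,
which forces the entry `1`. This describes the part of a mask to the right of its rightmost move. -/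
theorem IsRelativeMask.append_ones {p c : List B} {v z : W} {σ : List MaskEntry}
    (h : cs.IsRelativeMask p v z σ) (hv : cs.IsReducedMul v c) (hz : cs.IsReducedMul z c) :
    cs.IsRelativeMask (p ++ c) (v * cs.wordProd c) (z * cs.wordProd c)
      (σ ++ List.replicate c.length MaskEntry.one) := by
  induction c using List.reverseRecOn with
  | nil => simpa using h
  | append_singleton c s ih =>
    rw [IsReducedMul.concat_iff] at hv hz
    rw [List.length_append, List.length_singleton, List.replicate_succ', ← List.append_assoc,
      ← List.append_assoc, isRelativeMask_concat]
    refine Or.inr (Or.inr ⟨rfl, ?_, ?_, ?_⟩)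
    · rw [isRightDescent_iff_not_isRightDescent_mul]
      simpa [wordProd_append, mul_assoc] using hz.2
    · rw [isRightDescent_iff_not_isRightDescent_mul]
      simpa [wordProd_append, mul_assoc] using hv.2
    · simpa [wordProd_append, mul_assoc] using ih hv.1 hz.1

end RelativeMasks

end CoxeterSystem

namespace CoxeterSystem

/-! ### The map `φ` on group elements, and its symmetry. -/

section Moves

variable {B W : Type*} [Group W] {M : CoxeterMatrix B} {cs : CoxeterSystem M W}

theorem isDefect_oneMask_length {p c : List B} {t : B} {y x : W} {σ σ' : List MaskEntry}
    (h : cs.IsRelativeMask p y x σ) :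
    cs.IsDefect (p ++ t :: c) (oneMask (σ ++ σ')) p.length ↔ cs.IsRightDescent y t := by
  rw [oneMask_append, isDefect_length (by simp [h.length_eq]), h.wordProd_oneMask]

theorem isShiftedDescent_length {p c : List B} {t : B} {y x : W} {σ σ' : List MaskEntry}
    (h : cs.IsRelativeMask p y x σ) :
    cs.IsShiftedDescent (p ++ t :: c) (σ ++ MaskEntry.one :: σ') p.length ↔
      cs.BruhatLE (y * cs.simple t) x := by
  have hl := h.length_eq
  have h1 := initialProd_append (cs := cs) (ω := p) (ω' := t :: c) (σ := xMask σ)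
    (σ' := xMask (MaskEntry.one :: σ')) (by simp [hl]) le_rfl
  have h2 := initialProd_append (cs := cs) (ω := p ++ [t]) (ω' := c)
    (σ := oneMask (σ ++ [MaskEntry.one])) (σ' := oneMask σ') (by simp [hl]) le_rfl
  rw [initialProd_length (by simp [hl]), h.wordProd_xMask, ← xMask_append] at h1
  rw [initialProd_length (by simp [hl]), oneMask_append, subexpression_append (by simp [hl]),
    wordProd_append, h.wordProd_oneMask, ← oneMask_append, ← oneMask_append, List.append_assoc,
    List.append_assoc, List.length_append, List.singleton_append, List.singleton_append] at h2
  rw [IsShiftedDescent, h1]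
  change cs.BruhatLE (cs.initialProd _ _ (p.length + [t].length)) x ↔ _
  rw [h2]
  simp [oneMask, subexpression]

theorem isMove_one_length_iff {p c : List B} {t : B} {y x : W} {σ σ' : List MaskEntry}
    (h : cs.IsRelativeMask p y x σ) :
    cs.IsMove (p ++ t :: c) (σ ++ MaskEntry.one :: σ') p.length ↔
      cs.BruhatLE (y * cs.simple t) x := by
  rw [← isShiftedDescent_length h (c := c) (σ' := σ')]
  have he : (σ ++ MaskEntry.one :: σ')[p.length]? = some MaskEntry.one := by
    simp [← h.length_eq]
  simp [IsMove, Move₁, Move₂, Move₃, Move₄, he]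

theorem IsRelativeMask.combineMasks_constantMask {p : List B} {y y' x : W} {σ : List MaskEntry}
    (h : cs.IsRelativeMask p y x σ) (hy : cs.BruhatLE y' x) :
    cs.IsRelativeMask p y' x
      (combineMasks (xMask σ) (cs.constantMask (subexpression p (xMask σ)) y')) :=
  ⟨_, _, h.isConstantMask_xMask, isConstantMask_constantMask h.isConstantMask_xMask.isReduced
    (h.wordProd_xMask.symm ▸ hy), rfl⟩

theorem rewriteAt_length {p c : List B} {t : B} {x : W} {σ σ' : List MaskEntry}
    {e e' : MaskEntry} (h : σ.length = p.length) :
    cs.rewriteAt (p ++ t :: c) (σ ++ e :: σ') p.length x e' =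
      combineMasks (xMask σ) (cs.constantMask (subexpression p (xMask σ)) x) ++ e' :: σ' := by
  have h1 : (xMask (σ ++ e :: σ')).take p.length = xMask σ := by
    rw [xMask_append, List.take_left' (by simp [h])]
  have h2 : (p ++ t :: c).take p.length = p := List.take_left
  have h3 : (σ ++ e :: σ').drop (p.length + 1) = σ' := by
    rw [← h, List.drop_append]; simp
  rw [rewriteAt, h1, h2, h3]

/-- A move in position `p.length` multiplies the element reached by the `X`-mask by the letter in
this position. -/
theorem IsRelativeMask.applyMove {p c : List B} {t : B} {v z : W} {σ σ' : List MaskEntry}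
    {e : MaskEntry} (h : cs.IsRelativeMask (p ++ [t]) v z (σ ++ [e]))
    (hv : cs.BruhatLE v (z * cs.simple t)) :
    cs.IsMove (p ++ t :: c) (σ ++ e :: σ') p.length ∧
    ∃ σ₁ e₁, cs.applyMove (p ++ t :: c) (σ ++ e :: σ') p.length = σ₁ ++ e₁ :: σ' ∧
      cs.IsRelativeMask (p ++ [t]) v (z * cs.simple t) (σ₁ ++ [e₁]) := by
  have hl : σ.length = p.length := by simpa using h.length_eq
  have he : (σ ++ e :: σ')[p.length]? = some e := by simp [← hl]
  have hset (e' : MaskEntry) : (σ ++ e :: σ').set p.length e' = σ ++ e' :: σ' := by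
    simp [← hl]
  have htt : z * cs.simple t * cs.simple t = z := simple_mul_simple_cancel_right _ _
  have hdz : cs.IsRightDescent z t ↔ ¬ cs.IsRightDescent (z * cs.simple t) t :=
    cs.isRightDescent_iff_not_isRightDescent_mul
  rcases isRelativeMask_concat.mp h with ⟨rfl, h1, h2⟩ | ⟨rfl, h1, h3, h2⟩ | ⟨rfl, h1, h3, h2⟩
  · have hd := isDefect_oneMask_length (t := t) (c := c) (σ' := MaskEntry.X :: σ') h2
    by_cases hvt : cs.IsRightDescent v t
    · have hm : cs.Move₃ (p ++ t :: c) (σ ++ MaskEntry.X :: σ') p.length := ⟨he, hd.mpr hvt⟩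
      have hy : cs.initialProd (p ++ t :: c) (oneMask (σ ++ MaskEntry.X :: σ')) p.length *
          cs.wordProd (p ++ t :: c)[p.length]?.toList = v * cs.simple t := by
        have hg : (p ++ t :: c)[p.length]? = some t := by simp
        rw [oneMask_append, initialProd_append (by simp [hl]) le_rfl,
          initialProd_length (by simp [hl]), h2.wordProd_oneMask, hg, Option.toList_some,
          wordProd_singleton]
      refine ⟨Or.inr (Or.inr (Or.inl hm)), combineMasks (xMask σ)
        (cs.constantMask (subexpression p (xMask σ)) (v * cs.simple t)), MaskEntry.one, ?_,
        isRelativeMask_concat.mpr (Or.inr (Or.inr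
          ⟨rfl, not_not.mp fun h' => h1 (hdz.mpr h'), hvt, ?_⟩))⟩
      · rw [CoxeterSystem.applyMove, if_neg fun h' => h'.2 hm.2,
          if_neg (by simp [Move₂, he]), if_pos hm, rewriteAt_length hl, hy]
      · rw [htt]
        -- The rewritten constant mask exists because `v * t` lies below `v`, hence below the
        -- product of the `X`-mask.
        exact h2.combineMasks_constantMask ((mul_simple_bruhatLE hvt).trans h2.le)
    · have hm : cs.Move₁ (p ++ t :: c) (σ ++ MaskEntry.X :: σ') p.length :=
        ⟨he, fun h' => hvt (hd.mp h')⟩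
      refine ⟨Or.inl hm, σ, MaskEntry.zero, ?_, isRelativeMask_concat.mpr (Or.inr (Or.inl
        ⟨rfl, not_not.mp fun h' => h1 (hdz.mpr h'), hvt, htt.symm ▸ h2⟩))⟩
      rw [CoxeterSystem.applyMove, if_pos hm, hset]
  · have hm : Move₂ (σ ++ MaskEntry.zero :: σ') p.length := he
    refine ⟨Or.inr (Or.inl hm), σ, MaskEntry.X, ?_, isRelativeMask_concat.mpr (Or.inl
      ⟨rfl, hdz.mp h1, h2⟩)⟩
    rw [CoxeterSystem.applyMove, if_neg (by simp [Move₁, he]), if_pos hm, hset]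
  -- Only for an entry `1` does the existence of a move depend on `hv`: the `X`-mask has reached `z
  -- * t` before this position, so a shifted descent here is exactly `v ≤ z * t`.
  · have hs := isShiftedDescent_length (t := t) (c := c) (σ' := σ') h2
    rw [simple_mul_simple_cancel_right] at hs
    have hm : cs.Move₄ (p ++ t :: c) (σ ++ MaskEntry.one :: σ') p.length := ⟨he, hs.mpr hv⟩
    have hy : cs.initialProd (p ++ t :: c) (oneMask (σ ++ MaskEntry.one :: σ')) (p.length + 1)
        = v := by
      have h4 := initialProd_append (cs := cs) (ω := p ++ [t]) (ω' := c)
        (σ := oneMask (σ ++ [MaskEntry.one])) (σ' := oneMask σ') (by simp [hl]) le_rfl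
      rwa [initialProd_length (by simp [hl]), h.wordProd_oneMask, ← oneMask_append,
        List.append_assoc, List.append_assoc, List.length_append, List.singleton_append,
        List.singleton_append] at h4
    refine ⟨Or.inr (Or.inr (Or.inr hm)), combineMasks (xMask σ)
        (cs.constantMask (subexpression p (xMask σ)) v), MaskEntry.X, ?_,
        isRelativeMask_concat.mpr (Or.inl
          ⟨rfl, hdz.mp h1, h2.combineMasks_constantMask hv⟩)⟩
    rw [CoxeterSystem.applyMove, if_neg (by simp [Move₁, he]),
      if_neg (by simp [Move₂, he]), if_neg (by simp [Move₃, he]), if_pos hm, rewriteAt_length hl,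
      hy]

/-- The situation in which the rightmost move is in the position of the letter `t` of the
expression `p ++ t :: c`, when `v` and `z` are the elements reached after this letter. -/
structure IsMoveData (cs : CoxeterSystem M W) (p : List B) (t : B) (c : List B) (v z : W) :
    Prop where
  le : cs.BruhatLE v z
  le_mul : cs.BruhatLE v (z * cs.simple t)
  le_wordProd : cs.BruhatLE z (cs.wordProd (p ++ [t]))
  mul_le_wordProd : cs.BruhatLE (z * cs.simple t) (cs.wordProd (p ++ [t]))
  isReducedMul : cs.IsReducedMul v c
  noShiftedDescent : cs.NoShiftedDescent v z c
  noShiftedDescent_mul : cs.NoShiftedDescent v (z * cs.simple t) c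

theorem IsMoveData.symm {p c : List B} {t : B} {v z : W} (h : cs.IsMoveData p t c v z) :
    cs.IsMoveData p t c v (z * cs.simple t) := by
  constructor
  · exact h.le_mul
  · simpa using h.le
  · exact h.mul_le_wordProd
  · simpa using h.le_wordProd
  · exact h.isReducedMul
  · exact h.noShiftedDescent_mul
  · simpa using h.noShiftedDescent

theorem IsMoveData.isReducedMul_right {p c : List B} {t : B} {v z : W}
    (h : cs.IsMoveData p t c v z) : cs.IsReducedMul z c :=
  h.noShiftedDescent.isReducedMul h.le h.isReducedMul

theorem IsMoveData.maskMatching {p c : List B} {t : B} {v z : W}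
    (h : cs.IsMoveData p t c v z) (hω : cs.IsReduced (p ++ t :: c)) :
    ∃ σ, cs.IsRelativeMask (p ++ t :: c) (v * cs.wordProd c) (z * cs.wordProd c) σ ∧
      cs.IsRelativeMask (p ++ t :: c) (v * cs.wordProd c)
        (z * cs.simple t * cs.wordProd c) (cs.maskMatching (p ++ t :: c) σ) := by
  classical
  have hpt : cs.IsReduced (p ++ [t]) := by
    have := hω.take (p.length + 1)
    rwa [List.take_append, List.take_of_length_le (by simp), Nat.add_sub_cancel_left,
      List.take_succ_cons, List.take_zero] at this
  obtain ⟨σ₀, hσ₀⟩ := exists_isRelativeMask hpt h.le_wordProd h.le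
  have hne : σ₀ ≠ [] := by rintro rfl; simpa using hσ₀.length_eq
  obtain ⟨σ, e, rfl⟩ : ∃ σ e, σ₀ = σ ++ [e] := ⟨_, _, (List.dropLast_append_getLast hne).symm⟩
  have hl : σ.length = p.length := by simpa using hσ₀.length_eq
  set ρ := List.replicate c.length MaskEntry.one with hρ
  obtain ⟨hm, σ₁, e₁, h1, h2⟩ := hσ₀.applyMove (c := c) (σ' := ρ) h.le_mul
  refine ⟨σ ++ e :: ρ, ?_, ?_⟩
  · simpa using hσ₀.append_ones h.isReducedMul h.isReducedMul_right
  -- To the right of `t` all entries are `1`, so only the fourth condition could hold, and it is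
  -- excluded along `c`.
  · have hg : Nat.findGreatest (cs.IsMove (p ++ t :: c) (σ ++ e :: ρ)) (p ++ t :: c).length
        = p.length := by
      rw [Nat.findGreatest_eq_iff]
      refine ⟨by simp, fun _ => hm, fun k hk hk' => ?_⟩
      obtain ⟨i, rfl⟩ := Nat.exists_eq_add_of_lt hk
      rcases (show i ≤ c.length by simp at hk'; omega).lt_or_eq with hi | hi
      · obtain ⟨q, hc⟩ : ∃ q, c = c.take i ++ q :: c.drop (i + 1) :=
          ⟨c.get ⟨i, hi⟩, by simp⟩
        have hlc : c.length = (c.take i).length + (1 + (c.drop (i + 1)).length) := by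
          simp; omega
        have hr := IsReducedMul.append_iff.mp (hc ▸ h.isReducedMul)
        have hr' := IsReducedMul.append_iff.mp (hc ▸ h.isReducedMul_right)
        have h3 := hσ₀.append_ones hr.1 hr'.1
        have h4 := isMove_one_length_iff (t := q) (c := c.drop (i + 1))
          (σ' := List.replicate (c.drop (i + 1)).length MaskEntry.one) h3
        have e1 : p ++ [t] ++ c.take i ++ q :: c.drop (i + 1) = p ++ t :: c := by
          conv_rhs => rw [hc]
          simp
        have e2 : σ ++ [e] ++ List.replicate (c.take i).length MaskEntry.one ++
            MaskEntry.one :: List.replicate (c.drop (i + 1)).length MaskEntry.one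
              = σ ++ e :: ρ := by
          rw [hρ, hlc, List.replicate_add, List.replicate_add]
          simp
        have e3 : (p ++ [t] ++ c.take i).length = p.length + i + 1 := by
          simp; omega
        rw [e1, e2, e3] at h4
        rw [h4]
        exact h.noShiftedDescent _ _ _ hc
      -- The search bound is the length of the expression, one more than its last index; there is no
      -- entry at that index.
      · have hn : (σ ++ e :: ρ)[p.length + i + 1]? = none := by
          rw [List.getElem?_eq_none_iff]
          simp [hl, hρ]; omega
        simp [IsMove, Move₁, Move₂, Move₃, Move₄, hn]
    rw [CoxeterSystem.maskMatching, if_pos ⟨_, hm⟩, hg, h1]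
    simpa using h2.append_ones h.isReducedMul h.symm.isReducedMul_right

/-- The matching of `[y, w]` on the level of group elements. -/
def MatchingStep (cs : CoxeterSystem M W) (ω : List B) (y x x' : W) : Prop :=
  ∃ p t c v z, ω = p ++ t :: c ∧ y = v * cs.wordProd c ∧ x = z * cs.wordProd c ∧
    x' = z * cs.simple t * cs.wordProd c ∧ cs.IsMoveData p t c v z

theorem MatchingStep.symm {ω : List B} {y x x' : W} (h : cs.MatchingStep ω y x x') :
    cs.MatchingStep ω y x' x := by
  obtain ⟨p, t, c, v, z, h1, h2, h3, h4, h5⟩ := h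
  exact ⟨p, t, c, v, z * cs.simple t, h1, h2, h4, by simpa using h3, h5.symm⟩

/-- The recursive form of the matching, according to whether the rightmost move is at the last
letter. -/
theorem matchingStep_concat {ω : List B} {s : B} {y x x' : W} (hω : cs.IsReduced (ω ++ [s])) :
    cs.MatchingStep (ω ++ [s]) y x x' ↔
      (x' = x * cs.simple s ∧ cs.BruhatLE y x ∧ cs.BruhatLE y (x * cs.simple s) ∧
        cs.BruhatLE x (cs.wordProd (ω ++ [s])) ∧
        cs.BruhatLE (x * cs.simple s) (cs.wordProd (ω ++ [s]))) ∨
      (¬ cs.BruhatLE y (x * cs.simple s) ∧ ¬ cs.BruhatLE y (x' * cs.simple s) ∧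
        cs.IsRightDescent y s ∧
        cs.MatchingStep ω (y * cs.simple s) (x * cs.simple s) (x' * cs.simple s)) := by
  constructor
  · rintro ⟨p, t, c, v, z, h1, rfl, rfl, rfl, h2⟩
    rcases List.eq_nil_or_concat c with rfl | ⟨c, q, rfl⟩
    · obtain ⟨rfl, h3⟩ := List.append_inj' h1 rfl
      obtain rfl : s = t := by simpa using h3
      left
      simpa using ⟨h2.le, h2.le_mul, h2.le_wordProd, h2.mul_le_wordProd⟩
    · right
      rw [List.concat_eq_append] at *
      rw [← List.cons_append, ← List.append_assoc] at h1
      obtain ⟨rfl, h3⟩ := List.append_inj' h1 rfl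
      obtain rfl : s = q := by simpa using h3
      have h4 := NoShiftedDescent.concat_iff.mp h2.noShiftedDescent
      have h5 := NoShiftedDescent.concat_iff.mp h2.noShiftedDescent_mul
      have h6 := IsReducedMul.concat_iff.mp h2.isReducedMul
      simp only [wordProd_append, wordProd_singleton, ← mul_assoc, simple_mul_simple_cancel_right]
      refine ⟨h4.2, h5.2, ?_, p, t, c, v, z, rfl, rfl, rfl, rfl, h2.le, h2.le_mul, h2.le_wordProd,
        h2.mul_le_wordProd, h6.1, h4.1, h5.1⟩
      rw [isRightDescent_iff_not_isRightDescent_mul, simple_mul_simple_cancel_right]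
      exact h6.2
  · rintro (⟨rfl, h1, h2, h3, h4⟩ | ⟨h1, h2, h3, p, t, c, v, z, rfl, h5, h6, h7, h8⟩)
    · exact ⟨ω, s, [], y, x, rfl, by simp, by simp, by simp, h1, h2, h3, h4, isReducedMul_nil _,
        noShiftedDescent_nil _ _, noShiftedDescent_nil _ _⟩
    · have hc (a : W) : a * cs.wordProd (c ++ [s]) = a * cs.wordProd c * cs.simple s := by
        simp [wordProd_append, mul_assoc]
      refine ⟨p, t, c ++ [s], v, z, by simp, by simp [hc, ← h5], by simp [hc, ← h6],
        by simp [hc, ← h7], h8.le, h8.le_mul, h8.le_wordProd, h8.mul_le_wordProd, ?_, ?_, ?_⟩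
      · rw [IsReducedMul.concat_iff, ← h5, ← isRightDescent_iff_not_isRightDescent_mul]
        exact ⟨h8.isReducedMul, h3⟩
      · rw [NoShiftedDescent.concat_iff, ← h5, simple_mul_simple_cancel_right, ← h6]
        exact ⟨h8.noShiftedDescent, h1⟩
      · rw [NoShiftedDescent.concat_iff, ← h5, simple_mul_simple_cancel_right, ← h7]
        exact ⟨h8.noShiftedDescent_mul, h2⟩

theorem isReduced_of_append {p q : List B} (h : cs.IsReduced (p ++ q)) : cs.IsReduced q := by
  simpa using h.drop p.length

theorem exists_matchingStep {ω : List B} {y x : W} (hω : cs.IsReduced ω)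
    (hyx : cs.BruhatLE y x) (hx : cs.BruhatLE x (cs.wordProd ω)) (hy : y ≠ cs.wordProd ω) :
    ∃ x', cs.MatchingStep ω y x x' := by
  induction ω using List.reverseRecOn generalizing y x with
  | nil => exact absurd ((hyx.trans hx).eq_of_length_le (by simp)) hy
  | append_singleton ω s ih =>
    obtain ⟨h1, h2⟩ := cs.isReduced_append_singleton hω
    have h3 : cs.IsRightDescent (cs.wordProd (ω ++ [s])) s := by
      rw [isRightDescent_iff_not_isRightDescent_mul]
      simpa [wordProd_append] using h2
    by_cases hxs : cs.BruhatLE y (x * cs.simple s)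
    · exact ⟨x * cs.simple s, (matchingStep_concat hω).mpr
        (Or.inl ⟨rfl, hyx, hxs, hx, hx.mul_simple_le h3⟩)⟩
    · have hys : cs.IsRightDescent y s := by
        by_contra h; exact hxs (hyx.le_mul_simple h)
      have hxd : cs.IsRightDescent x s := by
        by_contra h; exact hxs (hyx.mul_simple_of_not_isRightDescent h)
      obtain ⟨x', p, t, c, v, z, rfl, h5, h6, h7, h8⟩ := ih h1
        (hyx.mul_simple_mul_simple_of_isRightDescent hys)
        (by simpa [wordProd_append] using hx.mul_simple_mul_simple_of_isRightDescent hxd)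
        (fun h => hy (by rw [wordProd_append, ← h]; simp))
      refine ⟨x' * cs.simple s, (matchingStep_concat hω).mpr (Or.inr ⟨hxs, ?_, hys, p, t, c, v, z,
        rfl, h5, h6, by simpa using h7, h8⟩)⟩
      have h9 : cs.IsReduced (t :: (c ++ [s])) := isReduced_of_append (p := p) (by simpa using hω)
      have h10 : cs.IsReducedMul v (c ++ [s]) := by
        rw [IsReducedMul.concat_iff, ← h5, ← isRightDescent_iff_not_isRightDescent_mul]
        exact ⟨h8.isReducedMul, hys⟩
      have h11 : cs.NoShiftedDescent v z (c ++ [s]) := by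
        rw [NoShiftedDescent.concat_iff, ← h5, simple_mul_simple_cancel_right, ← h6]
        exact ⟨h8.noShiftedDescent, hxs⟩
      -- The letter `s` admits no move for `x`; the invariance transfers this to the partner of `x`,
      -- as the recursive clause requires.
      rw [noShiftedDescent_mul_simple_iff h8.le h8.le_mul h9 h10,
        NoShiftedDescent.concat_iff, ← h5, simple_mul_simple_cancel_right, ← h7] at h11
      simpa using h11.2

theorem MatchingStep.matched {ω : List B} {y x x' : W} (hω : cs.IsReduced ω)
    (h : cs.MatchingStep ω y x x') :
    ∃ σ, cs.IsRelativeMask ω y x σ ∧ cs.IsRelativeMask ω y x' (cs.maskMatching ω σ) := by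
  obtain ⟨p, t, c, v, z, rfl, rfl, rfl, rfl, h⟩ := h
  exact h.maskMatching hω

theorem IsRelativeMask.le_wordProd {ω : List B} {y x : W} {σ : List MaskEntry}
    (hω : cs.IsReduced ω) (h : cs.IsRelativeMask ω y x σ) :
    cs.BruhatLE x (cs.wordProd ω) := by
  rw [← h.wordProd_xMask]
  exact cs.bruhatLE_of_sublist hω (subexpression_sublist _ _)

theorem IsRelativeMask.mem_bruhatInterval {ω : List B} {y x : W} {σ : List MaskEntry}
    (hω : cs.IsReduced ω) (h : cs.IsRelativeMask ω y x σ) :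
    x ∈ cs.bruhatInterval y (cs.wordProd ω) :=
  ⟨h.le, h.le_wordProd hω⟩

/-- Every element has some `MatchingStep`, which `φ` realizes; uniqueness of the relative mask then
leaves no other value for `φ`. -/
theorem matched_iff_matchingStep {ω : List B} {y x x' : W} (hω : cs.IsReduced ω)
    (hy : y ≠ cs.wordProd ω) :
    cs.Matched ω y x x' ↔ cs.MatchingStep ω y x x' := by
  constructor
  · rintro ⟨hx, -, σ, h1, h2⟩
    obtain ⟨x'', h3⟩ := exists_matchingStep hω hx.1 hx.2 hy
    obtain ⟨σ', h4, h5⟩ := h3.matched hω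
    obtain rfl := h1.unique h4
    rwa [← h2.wordProd_xMask, h5.wordProd_xMask]
  · intro h
    obtain ⟨σ, h4, h5⟩ := h.matched hω
    exact ⟨h4.mem_bruhatInterval hω, h5.mem_bruhatInterval hω, σ, h4, h5⟩

theorem Matched.unique {ω : List B} {y u v v' : W} (h : cs.Matched ω y u v)
    (h' : cs.Matched ω y u v') : v = v' := by
  obtain ⟨-, -, σ, h1, h2⟩ := h
  obtain ⟨-, -, σ', h3, h4⟩ := h'
  obtain rfl := h1.unique h3
  rw [← h2.wordProd_xMask, h4.wordProd_xMask]

theorem MatchingStep.bruhatCovers {ω : List B} {y x x' : W} (h : cs.MatchingStep ω y x x') :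
    cs.BruhatCovers x x' ∨ cs.BruhatCovers x' x := by
  obtain ⟨p, t, c, v, z, rfl, rfl, rfl, rfl, h⟩ := h
  have h1 : cs.length (z * cs.wordProd c) = cs.length z + c.length := h.isReducedMul_right
  have h2 : cs.length (z * cs.simple t * cs.wordProd c) = _ + _ := h.symm.isReducedMul_right
  by_cases hz : cs.IsRightDescent z t
  · have := cs.isRightDescent_iff.mp hz
    exact Or.inl ((h.isReducedMul_right.mul_le_mul (mul_simple_bruhatLE hz)).bruhatCovers
      (by omega))
  · have := cs.not_isRightDescent_iff.mp hz
    exact Or.inr ((h.symm.isReducedMul_right.mul_le_mul (bruhatLE_mul_simple hz)).bruhatCovers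
      (by omega))

end Moves

end CoxeterSystem

/-! ### Acyclicity. -/

/-- Applied with `u = v`: a cycle stays within one fibre of a function that never increases along
edges. -/
theorem Relation.TransGen.restrict_of_antitone {V : Type*} {R : V → V → Prop} {f : V → ℕ}
    (hf : ∀ a b, R a b → f b ≤ f a) {u v : V} (h : Relation.TransGen R u v) :
    f v ≤ f u ∧ (f u = f v →
      Relation.TransGen (fun a b => R a b ∧ f a = f u ∧ f b = f u) u v) := by
  induction h with
  | single h => exact ⟨hf _ _ h, fun e => .single ⟨h, rfl, e.symm⟩⟩
  | tail h h' ih =>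
    have := hf _ _ h'
    refine ⟨by omega, fun e => ?_⟩
    exact (ih.2 (by omega)).tail ⟨h', by omega, e.symm⟩

theorem Relation.TransGen.lt_of_forall_lt {V : Type*} {R : V → V → Prop} {f : V → ℕ}
    (hf : ∀ a b, R a b → f a < f b) {u v : V} (h : Relation.TransGen R u v) : f u < f v := by
  induction h with
  | single h => exact hf _ _ h
  | tail h h' ih => exact ih.trans (hf _ _ h')

theorem IsAcyclicMatching.mono {V : Type*} {E E' m : V → V → Prop} (h : IsAcyclicMatching E' m)
    (hE : ∀ u v, E u v → E' u v) : IsAcyclicMatching E m := fun u hu =>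
  h u (hu.lift id fun _ _ h => h.imp (And.imp_left (hE _ _)) (And.imp_left (hE _ _)))

namespace CoxeterSystem

section Acyclic

variable {B W : Type*} [Group W] {M : CoxeterMatrix B} {cs : CoxeterSystem M W}

/-- Strict Bruhat order on `[y, w]`, directed downwards. -/
def intervalGT (cs : CoxeterSystem M W) (y w u v : W) : Prop :=
  u ∈ cs.bruhatInterval y w ∧ v ∈ cs.bruhatInterval y w ∧ cs.BruhatLT v u

theorem BruhatLE.le_mul_simple_of_le {y a b : W} {s : B} (h : cs.BruhatLE b a)
    (hb : cs.BruhatLE y b) (hbs : cs.BruhatLE y (b * cs.simple s)) :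
    cs.BruhatLE y (a * cs.simple s) := by
  by_cases h1 : cs.IsRightDescent b s
  · exact hbs.trans (h.mul_simple_mul_simple_of_isRightDescent h1)
  · exact hb.trans (h.le_mul_simple h1)

/-- The minimal length in a coset of the subgroup generated by `s` is monotone. -/
theorem BruhatLE.min_length_le {a b : W} {s : B} (h : cs.BruhatLE b a) :
    min (cs.length b) (cs.length (b * cs.simple s)) ≤
      min (cs.length a) (cs.length (a * cs.simple s)) := by
  have h2 := h.length_le
  by_cases h1 : cs.IsRightDescent b s
  · have h3 := (h.mul_simple_mul_simple_of_isRightDescent h1).length_le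
    omega
  · have h3 := (h.le_mul_simple h1).length_le
    omega

theorem BruhatLT.eq_mul_simple_of_min_length_eq {a b : W} {s : B} (h : cs.BruhatLT b a)
    (he : min (cs.length a) (cs.length (a * cs.simple s)) =
      min (cs.length b) (cs.length (b * cs.simple s))) : b = a * cs.simple s := by
  have hl := h.length_lt
  have ha := cs.length_mul_simple a s
  by_cases hb : cs.IsRightDescent b s
  · have h3 := h.1.mul_simple_mul_simple_of_isRightDescent hb
    have h4 := cs.isRightDescent_iff.mp hb
    have h5 := h3.eq_of_length_le (by omega)
    exact absurd (mul_right_cancel h5) h.2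
  · have h4 := cs.not_isRightDescent_iff.mp hb
    exact (h.1.le_mul_simple hb).eq_of_length_le (by omega)

/-- Proved for all strict Bruhat relations instead of covers, so that the induction need not check
that multiplication by `s` preserves covers. -/
theorem isAcyclicMatching_matchingStep {ω : List B} (hω : cs.IsReduced ω) (y : W) :
    IsAcyclicMatching (cs.intervalGT y (cs.wordProd ω)) (cs.MatchingStep ω y) := by
  classical
  induction ω using List.reverseRecOn generalizing y with
  | nil =>
    have key (a b : W) : ¬ cs.intervalGT y (cs.wordProd []) a b := fun h => by
      have h1 := h.2.2.length_lt
      have h2 := h.1.2.length_le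
      simp at h2
      simp [h2] at h1
    intro u hu
    obtain ⟨v, h, -⟩ := Relation.TransGen.head'_iff.mp hu
    rcases h with h | h <;> exact key _ _ h.1
  | append_singleton ω s ih =>
    obtain ⟨h1, h2⟩ := cs.isReduced_append_singleton hω
    intro u hu
    set R := reverseMatched (cs.intervalGT y (cs.wordProd (ω ++ [s])))
      (cs.MatchingStep (ω ++ [s]) y) with hR
    have hg (a b : W) (hab : R a b) (hb : cs.BruhatLE y (b * cs.simple s)) :
        cs.BruhatLE y (a * cs.simple s) := by
      rcases hab with ⟨h, -⟩ | ⟨h, h'⟩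
      · exact h.2.2.1.le_mul_simple_of_le h.2.1.1 hb
      · rcases (matchingStep_concat hω).mp h' with h'' | h''
        · rw [h''.1]
          simpa using h''.2.1
        · exact absurd hb h''.1
    have hcyc := (hu.restrict_of_antitone
      (f := fun x => if cs.BruhatLE y (x * cs.simple s) then 1 else 0) (fun a b hab => by
        have := hg a b hab
        split_ifs <;> first | omega | tauto)).2 rfl
    by_cases hus : cs.BruhatLE y (u * cs.simple s)
    · simp only [hus, if_true, ite_eq_left_iff, zero_ne_one, imp_false, not_not] at hcyc
      have hcyc' := (hcyc.restrict_of_antitone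
        (f := fun x => min (cs.length x) (cs.length (x * cs.simple s))) (fun a b hab => by
          rcases hab with ⟨⟨h, -⟩ | ⟨h, h'⟩, ha, hb⟩
          · exact h.2.2.1.min_length_le
          · rcases (matchingStep_concat hω).mp h' with h'' | h''
            · rw [h''.1, simple_mul_simple_cancel_right, min_comm]
            · exact absurd hb h''.1)).2 rfl
      refine lt_irrefl _ (hcyc'.lt_of_forall_lt (f := cs.length) ?_)
      rintro a b ⟨⟨⟨h, h'⟩ | ⟨h, h'⟩, ha, hb⟩, ha', hb'⟩
      -- An unreversed edge with constant coset minimum joins `a` to `a * s`; but this pair is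
      -- matched, so the edge should have been reversed.
      · exfalso
        have hbe := h.2.2.eq_mul_simple_of_min_length_eq (ha'.trans hb'.symm)
        exact h' ((matchingStep_concat hω).mpr (Or.inl
          ⟨hbe, h.1.1, ha, h.1.2, hbe ▸ h.2.1.2⟩))
      · exact h.2.2.length_lt
    · simp only [hus, if_false, ite_eq_right_iff, one_ne_zero, imp_false] at hcyc
      -- No vertex of the cycle has a move at `s`, so multiplication by `s` respects both the order
      -- and the matching on these vertices.
      refine ih h1 (y * cs.simple s) (u * cs.simple s)
        (hcyc.lift (· * cs.simple s) ?_)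
      have hmem (x : W) (hx : x ∈ cs.bruhatInterval y (cs.wordProd (ω ++ [s])))
          (hxs : ¬ cs.BruhatLE y (x * cs.simple s)) : cs.IsRightDescent y s ∧
            cs.IsRightDescent x s ∧
            x * cs.simple s ∈ cs.bruhatInterval (y * cs.simple s) (cs.wordProd ω) := by
        have hys : cs.IsRightDescent y s := by
          by_contra h; exact hxs (hx.1.le_mul_simple h)
        have hxd : cs.IsRightDescent x s := by
          by_contra h; exact hxs (hx.1.mul_simple_of_not_isRightDescent h)
        exact ⟨hys, hxd, hx.1.mul_simple_mul_simple_of_isRightDescent hys,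
          by simpa [wordProd_append] using hx.2.mul_simple_mul_simple_of_isRightDescent hxd⟩
      have hgt (a b : W) (h : cs.intervalGT y (cs.wordProd (ω ++ [s])) a b)
          (ha : ¬ cs.BruhatLE y (a * cs.simple s)) (hb : ¬ cs.BruhatLE y (b * cs.simple s)) :
          cs.intervalGT (y * cs.simple s) (cs.wordProd ω) (a * cs.simple s) (b * cs.simple s) :=
        ⟨(hmem a h.1 ha).2.2, (hmem b h.2.1 hb).2.2,
          h.2.2.1.mul_simple_mul_simple_of_isRightDescent (hmem b h.2.1 hb).2.1,
          fun e => h.2.2.2 (mul_right_cancel e)⟩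
      rintro a b ⟨⟨h, h'⟩ | ⟨h, h'⟩, ha, hb⟩
      · exact Or.inl ⟨hgt a b h ha hb, fun hs => h' ((matchingStep_concat hω).mpr
          (Or.inr ⟨ha, hb, (hmem a h.1 ha).1, hs⟩))⟩
      · refine Or.inr ⟨hgt b a h hb ha, ?_⟩
        rcases (matchingStep_concat hω).mp h' with h'' | h''
        · exact absurd h''.2.2.1 hb
        · exact h''.2.2.2

end Acyclic

end CoxeterSystem

theorem mainTheorem3 {B W : Type*} [Group W] {M : CoxeterMatrix B} (cs : CoxeterSystem M W)
    (y w : W) (hyw : cs.BruhatLT y w) (ω : List B) (hω : cs.IsReduced ω)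
    (hw : cs.wordProd ω = w) :
    -- every element of the interval is encoded by exactly one relative mask and is matched
    (∀ x ∈ cs.bruhatInterval y w, ∃! σ, cs.IsRelativeMask ω y x σ) ∧
    (∀ x ∈ cs.bruhatInterval y w, ∃ x', cs.Matched ω y x x') ∧
    IsMatchingOf (cs.hasseEdge y w) (cs.Matched ω y) ∧
    IsAcyclicMatching (cs.hasseEdge y w) (cs.Matched ω y) := by
  subst hw
  have hm (u v : W) : cs.Matched ω y u v ↔ cs.MatchingStep ω y u v :=
    CoxeterSystem.matched_iff_matchingStep hω hyw.2
  refine ⟨fun x hx => ?_, fun x hx => ?_, ⟨fun u v h => ?_, fun u v h => ?_,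
    fun u v v' h h' => h.unique h'⟩, ?_⟩
  · obtain ⟨σ, h⟩ := CoxeterSystem.exists_isRelativeMask hω hx.2 hx.1
    exact ⟨σ, h, fun σ' h' => h'.unique h⟩
  · obtain ⟨x', h⟩ := CoxeterSystem.exists_matchingStep hω hx.1 hx.2 hyw.2
    exact ⟨x', (hm x x').mpr h⟩
  · exact (hm v u).mpr ((hm u v).mp h).symm
  · exact ((hm u v).mp h).bruhatCovers.imp (fun hc => ⟨h.1, h.2.1, hc⟩)
      fun hc => ⟨h.2.1, h.1, hc⟩
  · rw [show cs.Matched ω y = cs.MatchingStep ω y from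
      funext fun u => funext fun v => propext (hm u v)]
    exact (CoxeterSystem.isAcyclicMatching_matchingStep hω y).mono
      fun u v h => ⟨h.1, h.2.1, h.2.2.1⟩
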